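/- **Conventions.** A *2-category* is strict, as are 2-functors, 2-natural transformations, 2-adjunctions, 2-monads $T$ and $T$-algebras. An *$\mathcal F$-category* $\mathbb A$ is a 2-category (its 1-cells are called *loose*) with a class of *tight* 1-cells containing the identities and closed under composition; an *$\mathcal F$-functor* is a 2-functor preserving tight 1-cells. A 2-category is regarded as an $\mathcal F$-category with all 1-cells tight. An *$\mathcal F_2$-category* is a 2-category $\mathcal A_\phi$ (its 1-cells are called *very loose*) with two classes of 1-cells, *tight* $\subseteq$ *loose*, each containing the identities and closed under composition. Writing $\mathcal A_\tau\subseteq\mathcal A_\lambda\subseteq\mathcal A_\phi$ for the sub-2-categories with all objects, the tight (resp. loose) 1-cells and all 2-cells between them, it gives $\mathcal F$-categories $\mathbb A_{\tau,\lambda}$ and $\mathbb A_{\tau,\phi}$ (2-categories $\mathcal A_\lambda$, $\mathcal A_\phi$ with the tight 1-cells) and inclusion $\mathcal F$-functors $j:\mathcal A_\tau\to\mathbb A_{\tau,\lambda}$, $j:\mathbb A_{\tau,\lambda}\to\mathbb A_{\tau,\phi}$. For $w\in\{l,p,c\}$ and a loose $f:A\rightsquigarrow B$ in an $\mathcal F$-category,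 a *$\bar w$-cone* on $f$ with vertex $X$ consists of loose $r:X\rightsquigarrow A$, $s:X\rightsquigarrow B$ and a 2-cell $\alpha: s\Rightarrow fr$ if $w=l$, an invertible 2-cell $\alpha:s\cong fr$ if $w=p$, and a 2-cell $\alpha: fr\Rightarrow s$ if $w=c$. A *$\bar w$-limit* of $f$ is a $\bar w$-cone $(p,\lambda,q)$ with vertex $L$, with $p,q$ tight, such that (1) each $\bar w$-cone $(r,\alpha,s)$ on $f$ with vertex $X$ equals $(pt,\lambda t,qt)$ for a unique loose $t:X\rightsquigarrow L$; (2) for loose $t,t':X\rightsquigarrow L$, each pair of 2-cells $\theta_1:pt\Rightarrow pt'$, $\theta_2:qt\Rightarrow qt'$ compatible with $\lambda t$ and $\lambda t'$ (for $w\in\{l,p\}$: $(f\theta_1)\circ(\lambda t)=(\lambda t')\circ\theta_2$; for $w=c$: $\theta_2\circ(\lambda t)=(\lambda t')\circ(f\theta_1)$) equals $(p\varphi,q\varphi)$ for a unique 2-cell $\varphi:t\Rightarrow t'$; (3) a loose $t:X\rightsquigarrow L$ is tight if and only if $pt$ and $qt$ are tight. Here $\bar l=c$, $\bar p=p$, $\bar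 c=l$, i.e. these are colax, pseudo and lax limits, respectively. For a 2-monad $T$ on $\mathcal B$ and $w\in\{s,p,l,c\}$, $T\text{-Alg}_w$ is the 2-category of $T$-algebras, strict ($s$), pseudo ($p$), lax ($l$) or colax ($c$) morphisms and algebra 2-cells. For $w\in\{l,p,c\}$, $T\text{-}\mathbb A\mathrm{lg}_w$ is the $\mathcal F$-category with loose part $T\text{-Alg}_w$ whose tight 1-cells are the strict morphisms, with forgetful $\mathcal F$-functor $U_w:T\text{-}\mathbb A\mathrm{lg}_w\to\mathcal B$ and inclusion $j_w:T\text{-Alg}_s\to T\text{-}\mathbb A\mathrm{lg}_w$; for $w\in\{l,c\}$ there is the inclusion $j:T\text{-}\mathbb A\mathrm{lg}_p\to T\text{-}\mathbb A\mathrm{lg}_w$. **Theorem.** Let $w\in\{l,c\}$. Let an $\mathcal F_2$-category as above be given together with an $\mathcal F$-functor $H_{\tau,\phi}:\mathbb A_{\tau,\phi}\to\mathcal B$ to a 2-category; put $H_{\tau,\lambda}=H_{\tau,\phi}\circ j$ and let $H_\tau:\mathcal A_\tau\to\mathcal B$ be the restriction to tight 1-cells. Suppose that $H_\tau$ has a left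 2-adjoint, let $T$ be the induced 2-monad on $\mathcal B$ and $E:\mathcal A_\tau\to T\text{-Alg}_s$ the Eilenberg–Moore comparison 2-functor. Suppose that each loose morphism of $\mathbb A_{\tau,\lambda}$ has a pseudolimit ($\bar p$-limit) and each loose morphism of $\mathbb A_{\tau,\phi}$ has a $\bar w$-limit. Then there are a unique $\mathcal F$-functor $E_p:\mathbb A_{\tau,\lambda}\to T\text{-}\mathbb A\mathrm{lg}_p$ with $E_p\circ j=j_p\circ E$ and $U_p\circ E_p=H_{\tau,\lambda}$, and a unique $\mathcal F$-functor $E_w:\mathbb A_{\tau,\phi}\to T\text{-}\mathbb A\mathrm{lg}_w$ with $E_w\circ j=j_w\circ E$ (where now $j:\mathcal A_\tau\to\mathbb A_{\tau,\phi}$ is the inclusion) and $U_w\circ E_w=H_{\tau,\phi}$, and these satisfy $$ j\circ E_p \;=\; E_w\circ j \;:\; \mathbb A_{\tau,\lambda}\longrightarrow T\text{-}\mathbb A\mathrm{lg}_w . $$ -/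

import Mathlib

open CategoryTheory Bicategory

universe w v u w₁ v₁ u₁ w₂ v₂ u₂ w₃ v₃ u₃

/-- The four flavours of morphism: strict, pseudo, lax, colax. -/
inductive Weakness
  | s | p | l | c

namespace Weakness

/-- The order generated by `s ≤ p`, `p ≤ l`, `p ≤ c`. -/
def Le : Weakness → Weakness → Prop
  | s, _ => True
  | p, s => False
  | p, _ => True
  | l, l => True
  | c, c => True
  | _, _ => False

theorem s_le (w : Weakness) : Le s w := by cases w <;> trivial

theorem p_le {w : Weakness} (h : w = l ∨ w = c) : Le p w := by
  rcases h with rfl | rfl <;> trivial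

/-- A `w`-cell from `x` to `y` in a category: an identity (`s`), an isomorphism (`p`),
a morphism `x ⟶ y` (`l`) or a morphism `y ⟶ x` (`c`). -/
def Cell {K : Type u} [Category.{v} K] : Weakness → K → K → Type v
  | s, x, y => ULift (PLift (x = y))
  | p, x, y => x ≅ y
  | l, x, y => x ⟶ y
  | c, x, y => y ⟶ x

namespace Cell

section
variable {K : Type u} [Category.{v} K] {L : Type u₁} [Category.{v₁} L]

/-- The `w`-cell given by an identity. -/
def ofEq {x y : K} (h : x = y) : (w : Weakness) → Cell w x y
  | s => ⟨⟨h⟩⟩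
  | p => eqToIso h
  | l => eqToHom h
  | c => eqToHom h.symm

/-- Composition of `w`-cells. -/
def comp {x y z : K} : {w : Weakness} → Cell w x y → Cell w y z → Cell w x z
  | s, φ, ψ => ⟨⟨φ.down.down.trans ψ.down.down⟩⟩
  | p, φ, ψ => Iso.trans (X := x) (Y := y) (Z := z) φ ψ
  | l, φ, ψ => CategoryStruct.comp (X := x) (Y := y) (Z := z) φ ψ
  | c, φ, ψ => CategoryStruct.comp (X := z) (Y := y) (Z := x) ψ φ

/-- The image of a `w`-cell under a functor. -/
def map (F : K ⥤ L) {x y : K} : {w : Weakness} → Cell w x y → Cell w (F.obj x) (F.obj y)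
  | s, φ => ⟨⟨congrArg F.obj φ.down.down⟩⟩
  | p, φ => F.mapIso (X := x) (Y := y) φ
  | l, φ => F.map (X := x) (Y := y) φ
  | c, φ => F.map (X := y) (Y := x) φ

/-- A `w₁`-cell regarded as a `w₂`-cell when `w₁ ≤ w₂`. -/
def incl {x y : K} : {w₁ w₂ : Weakness} → Le w₁ w₂ → Cell w₁ x y → Cell w₂ x y
  | s, w₂, _, φ => ofEq φ.down.down w₂
  | p, p, _, φ => φ
  | p, l, _, φ => Iso.hom (X := x) (Y := y) φ
  | p, c, _, φ => Iso.inv (X := x) (Y := y) φ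
  | l, l, _, φ => φ
  | c, c, _, φ => φ

/-- Commutativity of the square with `w`-cells `φ : x → y`, `ψ : x' → y'` as horizontal sides
and morphisms `α : x ⟶ x'`, `β : y ⟶ y'` as vertical sides. -/
def Square {x y x' y' : K} : {w : Weakness} → Cell w x y → Cell w x' y' →
    (x ⟶ x') → (y ⟶ y') → Prop
  | s, φ, ψ, α, β => α ≫ eqToHom ψ.down.down = eqToHom φ.down.down ≫ β
  | p, φ, ψ, α, β =>
      α ≫ Iso.hom (X := x') (Y := y') ψ = Iso.hom (X := x) (Y := y) φ ≫ β
  | l, φ, ψ, α, β =>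
      CategoryStruct.comp (X := x) (Y := x') (Z := y') α ψ =
        CategoryStruct.comp (X := x) (Y := y) (Z := y') φ β
  | c, φ, ψ, α, β =>
      CategoryStruct.comp (X := y) (Y := x) (Z := x') φ α =
        CategoryStruct.comp (X := y) (Y := y') (Z := x') β ψ

variable {w : Weakness}

theorem comp_assoc {x y z t : K} (φ : Cell w x y) (ψ : Cell w y z) (χ : Cell w z t) :
    (φ.comp ψ).comp χ = φ.comp (ψ.comp χ) := by
  cases w
  · rfl
  · exact Iso.ext (Category.assoc _ _ _)
  · exact Category.assoc _ _ _
  · exact (Category.assoc _ _ _).symm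

theorem ofEq_comp {x y : K} (h : x = x) (φ : Cell w x y) : (ofEq h w).comp φ = φ := by
  cases w
  · rfl
  · exact Iso.ext (Category.id_comp _)
  · exact Category.id_comp _
  · exact Category.comp_id _

theorem comp_ofEq {x y : K} (h : y = y) (φ : Cell w x y) : φ.comp (ofEq h w) = φ := by
  cases w
  · rfl
  · exact Iso.ext (Category.comp_id _)
  · exact Category.comp_id _
  · exact Category.id_comp _

theorem ofEq_comp_ofEq {x y z : K} (h : x = y) (h' : y = z) :
    (ofEq h w).comp (ofEq h' w) = ofEq (h.trans h') w := by
  subst h; exact ofEq_comp rfl _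

theorem ofEq_comp_ofEq_assoc {x y z t : K} (h : x = y) (h' : y = z) (φ : Cell w z t) :
    (ofEq h w).comp ((ofEq h' w).comp φ) = (ofEq (h.trans h') w).comp φ := by
  rw [← comp_assoc, ofEq_comp_ofEq]

theorem map_comp (F : K ⥤ L) {x y z : K} (φ : Cell w x y) (ψ : Cell w y z) :
    (φ.comp ψ).map F = (φ.map F).comp (ψ.map F) := by
  cases w
  · rfl
  · exact Iso.ext (F.map_comp _ _)
  · exact F.map_comp _ _
  · exact F.map_comp _ _

theorem map_ofEq (F : K ⥤ L) {x y : K} (h : x = y) :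
    (ofEq h w).map F = ofEq (congrArg F.obj h) w := by
  subst h
  cases w
  · rfl
  · exact Iso.ext (F.map_id _)
  · exact F.map_id _
  · exact F.map_id _

theorem map_congr {F G : K ⥤ L} (h : F = G) {x y : K} (φ : Cell w x y) :
    φ.map F = (ofEq (by rw [h]) w).comp ((φ.map G).comp (ofEq (by rw [h]) w)) := by
  subst h; rw [ofEq_comp, comp_ofEq]

theorem map_map {M : Type u₂} [Category.{v₂} M] (F : K ⥤ L) (G : L ⥤ M) {x y : K}
    (φ : Cell w x y) : (φ.map F).map G = φ.map (F ⋙ G) := by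
  cases w <;> rfl

theorem map_id {x y : K} (φ : Cell w x y) : φ.map (𝟭 K) = φ := by
  cases w <;> rfl

theorem incl_ofEq {w₂ : Weakness} (hw : Le w w₂) {x y : K} (h : x = y) :
    (ofEq h w).incl hw = ofEq h w₂ := by
  subst h
  cases w <;> cases w₂ <;> first | rfl | exact hw.elim

theorem incl_comp {w₂ : Weakness} (hw : Le w w₂) {x y z : K} (φ : Cell w x y)
    (ψ : Cell w y z) : (φ.comp ψ).incl hw = (φ.incl hw).comp (ψ.incl hw) := by
  cases w
  · obtain ⟨⟨rfl⟩⟩ := φ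
    obtain ⟨⟨rfl⟩⟩ := ψ
    exact (ofEq_comp rfl _).symm
  all_goals cases w₂ <;> first | rfl | exact hw.elim

theorem incl_map {w₂ : Weakness} (hw : Le w w₂) (F : K ⥤ L) {x y : K} (φ : Cell w x y) :
    (φ.map F).incl hw = (φ.incl hw).map F := by
  cases w
  · obtain ⟨⟨rfl⟩⟩ := φ
    exact (map_ofEq F rfl).symm
  all_goals cases w₂ <;> first | rfl | exact hw.elim

theorem Square.incl {w₂ : Weakness} (hw : Le w w₂) {x y x' y' : K} {φ : Cell w x y}
    {ψ : Cell w x' y'} {α : x ⟶ x'} {β : y ⟶ y'} (h : Square φ ψ α β) :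
    Square (φ.incl hw) (ψ.incl hw) α β := by
  cases w
  · obtain ⟨⟨rfl⟩⟩ := φ
    obtain ⟨⟨rfl⟩⟩ := ψ
    have h' : α = β := by simpa [Square] using h
    subst h'
    cases w₂ <;> simp [Square, Cell.incl, ofEq]
  · cases w₂
    · exact hw.elim
    · exact h
    · exact h
    · exact ((Iso.inv_comp_eq (X := x) (Y := y) φ).2
        (((Iso.eq_comp_inv (X := x') (Y := y') ψ).2 h).trans (Category.assoc _ _ _)))
  all_goals cases w₂ <;> first | exact h | exact hw.elim

theorem Square.refl {x y : K} (φ : Cell w x y) : Square φ φ (𝟙 x) (𝟙 y) := by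
  cases w
  · simp [Square]
  · exact (Category.id_comp _).trans (Category.comp_id _).symm
  · exact (Category.id_comp _).trans (Category.comp_id _).symm
  · exact (Category.comp_id _).trans (Category.id_comp _).symm

theorem Square.vcomp {x y x' y' x'' y'' : K} {φ : Cell w x y} {ψ : Cell w x' y'}
    {χ : Cell w x'' y''} {α : x ⟶ x'} {β : y ⟶ y'} {α' : x' ⟶ x''} {β' : y' ⟶ y''}
    (h : Square φ ψ α β) (h' : Square ψ χ α' β') : Square φ χ (α ≫ α') (β ≫ β') := by
  cases w
  · dsimp [Square] at h h' ⊢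
    rw [Category.assoc, h', ← Category.assoc, h, Category.assoc]
  · dsimp [Square] at h h' ⊢
    rw [Category.assoc, h', ← Category.assoc, h, Category.assoc]
  · change x ⟶ y at φ
    change x' ⟶ y' at ψ
    change x'' ⟶ y'' at χ
    change α ≫ ψ = φ ≫ β at h
    change α' ≫ χ = ψ ≫ β' at h'
    change (α ≫ α') ≫ χ = φ ≫ β ≫ β'
    rw [Category.assoc, h', ← Category.assoc, h, Category.assoc]
  · change y ⟶ x at φ
    change y' ⟶ x' at ψ
    change y'' ⟶ x'' at χ
    change φ ≫ α = β ≫ ψ at h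
    change ψ ≫ α' = β' ≫ χ at h'
    change φ ≫ α ≫ α' = (β ≫ β') ≫ χ
    rw [← Category.assoc, h, Category.assoc, h', Category.assoc]

theorem Square.hcomp {x y z x' y' z' : K} {φ : Cell w x y} {φ' : Cell w x' y'}
    {ψ : Cell w y z} {ψ' : Cell w y' z'} {α : x ⟶ x'} {β : y ⟶ y'} {γ : z ⟶ z'}
    (h : Square φ φ' α β) (h' : Square ψ ψ' β γ) :
    Square (φ.comp ψ) (φ'.comp ψ') α γ := by
  cases w
  · obtain ⟨⟨rfl⟩⟩ := φ
    obtain ⟨⟨rfl⟩⟩ := φ'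
    have h₀ : α = β := by simpa [Square] using h
    subst h₀
    exact h'
  · change x ≅ y at φ
    change x' ≅ y' at φ'
    change y ≅ z at ψ
    change y' ≅ z' at ψ'
    change α ≫ φ'.hom = φ.hom ≫ β at h
    change β ≫ ψ'.hom = ψ.hom ≫ γ at h'
    change α ≫ φ'.hom ≫ ψ'.hom = (φ.hom ≫ ψ.hom) ≫ γ
    rw [← Category.assoc, h, Category.assoc, h', Category.assoc]
  · change x ⟶ y at φ
    change x' ⟶ y' at φ'
    change y ⟶ z at ψ
    change y' ⟶ z' at ψ'
    change α ≫ φ' = φ ≫ β at h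
    change β ≫ ψ' = ψ ≫ γ at h'
    change α ≫ φ' ≫ ψ' = (φ ≫ ψ) ≫ γ
    rw [← Category.assoc, h, Category.assoc, h', Category.assoc]
  · change y ⟶ x at φ
    change y' ⟶ x' at φ'
    change z ⟶ y at ψ
    change z' ⟶ y' at ψ'
    change φ ≫ α = β ≫ φ' at h
    change ψ ≫ β = γ ≫ ψ' at h'
    change (ψ ≫ φ) ≫ α = γ ≫ ψ' ≫ φ'
    rw [Category.assoc, h, ← Category.assoc, h', Category.assoc]

theorem Square.map (F : K ⥤ L) {x y x' y' : K} {φ : Cell w x y} {ψ : Cell w x' y'}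
    {α : x ⟶ x'} {β : y ⟶ y'} (h : Square φ ψ α β) :
    Square (φ.map F) (ψ.map F) (F.map α) (F.map β) := by
  cases w
  · obtain ⟨⟨rfl⟩⟩ := φ
    obtain ⟨⟨rfl⟩⟩ := ψ
    have h₀ : α = β := by simpa [Square] using h
    subst h₀
    simp [Square]
  all_goals
    exact (F.map_comp _ _).symm.trans ((congrArg F.map h).trans (F.map_comp _ _))

theorem square_ofEq {x y x' y' : K} (h : x = y) (h' : x' = y') {α : x ⟶ x'} {β : y ⟶ y'}
    (H : α ≫ eqToHom h' = eqToHom h ≫ β) : Square (ofEq h w) (ofEq h' w) α β := by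
  subst h h'
  have h₀ : α = β := by simpa using H
  subst h₀
  cases w <;> simp [Square, ofEq]

end

section
variable {B : Type u} [Bicategory.{w, v} B] {a b c : B} {k : Weakness}

/-- Whiskering of a `w`-cell by a 1-cell on the left: `f ◁ φ`. -/
def whiskerLeft (f : a ⟶ b) {g h : b ⟶ c} (φ : Cell k g h) : Cell k (f ≫ g) (f ≫ h) :=
  φ.map (Bicategory.precomp c f)

/-- Whiskering of a `w`-cell by a 1-cell on the right: `φ ▷ h`. -/
def whiskerRight {f g : a ⟶ b} (φ : Cell k f g) (h : b ⟶ c) : Cell k (f ≫ h) (g ≫ h) :=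
  φ.map (Bicategory.postcomp a h)

/-- The image of a `w`-cell under the action of a 2-functor on hom-categories. -/
def mapCell {C : Type u₁} [Bicategory.{w₁, v₁} C] (T : StrictPseudofunctor B C)
    {f g : a ⟶ b} (φ : Cell k f g) : Cell k (T.map f) (T.map g) :=
  φ.map (T.mapFunctor a b)

theorem whiskerLeft_vcomp (f : a ⟶ b) {x y z : b ⟶ c} (φ : Cell k x y) (ψ : Cell k y z) :
    (φ.comp ψ).whiskerLeft f = (φ.whiskerLeft f).comp (ψ.whiskerLeft f) := map_comp _ _ _

theorem whiskerLeft_ofEq (f : a ⟶ b) {x y : b ⟶ c} (h : x = y) :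
    (ofEq h k).whiskerLeft f = ofEq (congrArg (f ≫ ·) h) k := map_ofEq _ _

theorem whiskerRight_vcomp {x y z : a ⟶ b} (φ : Cell k x y) (ψ : Cell k y z) (f : b ⟶ c) :
    (φ.comp ψ).whiskerRight f = (φ.whiskerRight f).comp (ψ.whiskerRight f) := map_comp _ _ _

theorem whiskerRight_ofEq {x y : a ⟶ b} (h : x = y) (f : b ⟶ c) :
    (ofEq h k).whiskerRight f = ofEq (congrArg (· ≫ f) h) k := map_ofEq _ _

theorem mapCell_vcomp {C : Type u₁} [Bicategory.{w₁, v₁} C] (T : StrictPseudofunctor B C)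
    {x y z : a ⟶ b} (φ : Cell k x y) (ψ : Cell k y z) :
    (φ.comp ψ).mapCell T = (φ.mapCell T).comp (ψ.mapCell T) := map_comp _ _ _

theorem mapCell_ofEq {C : Type u₁} [Bicategory.{w₁, v₁} C] (T : StrictPseudofunctor B C)
    {x y : a ⟶ b} (h : x = y) :
    (ofEq h k).mapCell T = ofEq (congrArg (fun f => T.map f) h) k := map_ofEq _ _

theorem incl_whiskerLeft {k' : Weakness} (hk : Le k k') (f : a ⟶ b) {x y : b ⟶ c}
    (φ : Cell k x y) : (φ.whiskerLeft f).incl hk = (φ.incl hk).whiskerLeft f := incl_map _ _ _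

theorem incl_whiskerRight {k' : Weakness} (hk : Le k k') {x y : a ⟶ b}
    (φ : Cell k x y) (f : b ⟶ c) : (φ.whiskerRight f).incl hk = (φ.incl hk).whiskerRight f :=
  incl_map _ _ _

theorem incl_mapCell {k' : Weakness} (hk : Le k k') {C : Type u₁} [Bicategory.{w₁, v₁} C]
    (T : StrictPseudofunctor B C) {x y : a ⟶ b} (φ : Cell k x y) :
    (φ.mapCell T).incl hk = (φ.incl hk).mapCell T := incl_map _ _ _

end

end Cell

end Weakness

open Weakness

section TwoCategories

/-! A 2-category is a strict bicategory, and a 2-functor is a `StrictPseudofunctor` (between strict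
bicategories its structure isomorphisms are identities). Composites `f ≫ g` are in diagrammatic
order. -/

theorem eqToHom_conj {K : Type u} [Category.{v} K] {x y z t m n : K} {α : y ⟶ z} {β : m ⟶ n}
    {h₁ : x = y} {h₂ : z = t} {h₃ : x = m} {h₄ : n = t}
    (h : eqToHom h₁ ≫ α ≫ eqToHom h₂ = eqToHom h₃ ≫ β ≫ eqToHom h₄) (h₅ : z = n) (h₆ : y = m) :
    α ≫ eqToHom h₅ = eqToHom h₆ ≫ β := by
  subst h₁ h₂ h₃ h₄
  simpa using h

/-- A 2-adjunction `F ⊣ G` between 2-categories: 2-natural unit and counit satisfying the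
triangle identities. -/
structure TwoAdjunction {A : Type u} [Bicategory.{w, v} A] {B : Type u₁} [Bicategory.{w₁, v₁} B]
    (F : StrictPseudofunctor B A) (G : StrictPseudofunctor A B) where
  unit : ∀ b : B, b ⟶ G.obj (F.obj b)
  unit_nat : ∀ {b c : B} (f : b ⟶ c), f ≫ unit c = unit b ≫ G.map (F.map f)
  unit_nat₂ : ∀ {b c : B} {f g : b ⟶ c} (α : f ⟶ g),
    α ▷ unit c ≫ eqToHom (unit_nat g) = eqToHom (unit_nat f) ≫ unit b ◁ G.map₂ (F.map₂ α)
  counit : ∀ a : A, F.obj (G.obj a) ⟶ a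
  counit_nat : ∀ {a a' : A} (f : a ⟶ a'), F.map (G.map f) ≫ counit a' = counit a ≫ f
  counit_nat₂ : ∀ {a a' : A} {f g : a ⟶ a'} (α : f ⟶ g),
    F.map₂ (G.map₂ α) ▷ counit a' ≫ eqToHom (counit_nat g) =
      eqToHom (counit_nat f) ≫ counit a ◁ α
  left_triangle : ∀ b : B, F.map (unit b) ≫ counit (F.obj b) = 𝟙 (F.obj b)
  right_triangle : ∀ a : A, unit (G.obj a) ≫ G.map (counit a) = 𝟙 (G.obj a)

/-- A 2-monad on a 2-category: a 2-functor `T` with 2-natural `η : 1 → T` and `μ : TT → T`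
satisfying the monad axioms. -/
structure TwoMonad (B : Type u) [Bicategory.{w, v} B] where
  T : StrictPseudofunctor B B
  η : ∀ b : B, b ⟶ T.obj b
  η_nat : ∀ {b c : B} (f : b ⟶ c), f ≫ η c = η b ≫ T.map f
  η_nat₂ : ∀ {b c : B} {f g : b ⟶ c} (α : f ⟶ g),
    α ▷ η c ≫ eqToHom (η_nat g) = eqToHom (η_nat f) ≫ η b ◁ T.map₂ α
  μ : ∀ b : B, T.obj (T.obj b) ⟶ T.obj b
  μ_nat : ∀ {b c : B} (f : b ⟶ c), T.map (T.map f) ≫ μ c = μ b ≫ T.map f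
  μ_nat₂ : ∀ {b c : B} {f g : b ⟶ c} (α : f ⟶ g),
    T.map₂ (T.map₂ α) ▷ μ c ≫ eqToHom (μ_nat g) = eqToHom (μ_nat f) ≫ μ b ◁ T.map₂ α
  left_unit : ∀ b : B, η (T.obj b) ≫ μ b = 𝟙 (T.obj b)
  right_unit : ∀ b : B, T.map (η b) ≫ μ b = 𝟙 (T.obj b)
  assoc : ∀ b : B, T.map (μ b) ≫ μ b = μ (T.obj b) ≫ μ b

/-- The 2-monad `GF` induced by a 2-adjunction `F ⊣ G`. -/
def TwoAdjunction.toTwoMonad {A : Type u} [Bicategory.{w, v} A]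
    {B : Type u₁} [Bicategory.{w₁, v₁} B]
    {F : StrictPseudofunctor B A} {G : StrictPseudofunctor A B} (adj : TwoAdjunction F G) :
    TwoMonad B where
  T := F.comp G
  η := adj.unit
  η_nat := adj.unit_nat
  η_nat₂ := adj.unit_nat₂
  μ b := G.map (adj.counit (F.obj b))
  μ_nat f := by
    have h := congrArg G.map (adj.counit_nat (F.map f))
    rw [G.map_comp, G.map_comp] at h
    exact h
  μ_nat₂ α := by
    have h := congrArg (fun x => G.map₂ x) (adj.counit_nat₂ (F.map₂ α))
    simp only [PrelaxFunctor.map₂_comp, PrelaxFunctor.map₂_eqToHom,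
      Pseudofunctor.map₂_whisker_left, Pseudofunctor.map₂_whisker_right,
      StrictPseudofunctor.mapComp_eq_eqToIso] at h
    simp only [Category.assoc, eqToHom_trans, eqToHom_trans_assoc, eqToIso.hom,
      eqToIso.inv] at h
    exact eqToHom_conj h _ _
  left_unit b := adj.right_triangle (F.obj b)
  right_unit b := by
    have h := congrArg G.map (adj.left_triangle b)
    exact (G.map_comp _ _).symm.trans (h.trans (G.map_id _))
  assoc b := by
    have h := congrArg G.map (adj.counit_nat (adj.counit (F.obj b)))
    rw [G.map_comp, G.map_comp] at h
    exact h

end TwoCategories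

section CellLemmas

variable {B : Type u} [Bicategory.{w, v} B] [Strict B]
  {a b c d : B} {k : Weakness}

theorem precomp_comp_eq (f : a ⟶ b) (g : b ⟶ c) (d : B) :
    precomp d (f ≫ g) = precomp d g ⋙ precomp d f := by
  refine CategoryTheory.Functor.ext (fun h => Strict.assoc f g h) fun X Y η => ?_
  change (f ≫ g) ◁ η = _ ≫ (f ◁ g ◁ η) ≫ _
  simp [Strict.associator_eqToIso]
  rfl

theorem postcomp_comp_eq (a : B) (f : b ⟶ c) (g : c ⟶ d) :
    postcomp a f ⋙ postcomp a g = postcomp a (f ≫ g) := by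
  refine (CategoryTheory.Functor.ext (fun h => (Strict.assoc h f g).symm) fun X Y η => ?_).symm
  change η ▷ (f ≫ g) = _ ≫ ((η ▷ f) ▷ g) ≫ _
  simp [Strict.associator_eqToIso]
  rfl

theorem pre_post_eq (f : a ⟶ b) (g : c ⟶ d) :
    precomp c f ⋙ postcomp a g = postcomp b g ⋙ precomp d f := by
  refine CategoryTheory.Functor.ext (fun h => Strict.assoc f h g) fun X Y η => ?_
  change (f ◁ η) ▷ g = _ ≫ (f ◁ η ▷ g) ≫ _
  simp [Strict.associator_eqToIso]
  rfl

theorem precomp_id_eq (a b : B) : precomp b (𝟙 a) = 𝟭 (a ⟶ b) := by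
  refine CategoryTheory.Functor.ext (fun h => Strict.id_comp h) fun X Y η => ?_
  change 𝟙 a ◁ η = _ ≫ η ≫ _
  simp [Strict.leftUnitor_eqToIso]
  rfl

theorem postcomp_id_eq (a b : B) : postcomp a (𝟙 b) = 𝟭 (a ⟶ b) := by
  refine CategoryTheory.Functor.ext (fun h => Strict.comp_id h) fun X Y η => ?_
  change η ▷ 𝟙 b = _ ≫ η ≫ _
  simp [Strict.rightUnitor_eqToIso]
  rfl

end CellLemmas

section

variable {B : Type u} [Bicategory.{w, v} B] {C : Type u₁} [Bicategory.{w₁, v₁} C] {a b c : B}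

theorem map_precomp_eq (T : StrictPseudofunctor B C) (f : a ⟶ b) (c : B) :
    precomp c f ⋙ T.mapFunctor a c = T.mapFunctor b c ⋙ precomp (T.obj c) (T.map f) := by
  refine CategoryTheory.Functor.ext (fun h => T.map_comp f h) fun X Y η => ?_
  change T.map₂ (f ◁ η) = _ ≫ (T.map f ◁ T.map₂ η) ≫ _
  simp [T.mapComp_eq_eqToIso]
  rfl

theorem map_postcomp_eq (T : StrictPseudofunctor B C) (a : B) (g : b ⟶ c) :
    postcomp a g ⋙ T.mapFunctor a c = T.mapFunctor a b ⋙ postcomp (T.obj a) (T.map g) := by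
  refine CategoryTheory.Functor.ext (fun h => T.map_comp h g) fun X Y η => ?_
  change T.map₂ (η ▷ g) = _ ≫ (T.map₂ η ▷ T.map g) ≫ _
  simp [T.mapComp_eq_eqToIso]
  rfl

end

namespace Weakness.Cell

variable {B : Type u} [Bicategory.{w, v} B] [Strict B] {a b c d : B} {k : Weakness}

theorem whiskerLeft_comp (f : a ⟶ b) (g : b ⟶ c) {x y : c ⟶ d} (φ : Cell k x y) :
    φ.whiskerLeft (f ≫ g) = (ofEq (Strict.assoc _ _ _) k).comp
      (((φ.whiskerLeft g).whiskerLeft f).comp (ofEq (Strict.assoc _ _ _).symm k)) :=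
  (map_congr (precomp_comp_eq f g d) φ).trans (by rw [← map_map]; rfl)

theorem whiskerRight_comp {x y : a ⟶ b} (φ : Cell k x y) (f : b ⟶ c) (g : c ⟶ d) :
    φ.whiskerRight (f ≫ g) = (ofEq (Strict.assoc _ _ _).symm k).comp
      (((φ.whiskerRight f).whiskerRight g).comp (ofEq (Strict.assoc _ _ _) k)) :=
  (map_congr (postcomp_comp_eq a f g).symm φ).trans (by rw [← map_map]; rfl)

theorem whiskerLeft_whiskerRight (f : a ⟶ b) {x y : b ⟶ c} (φ : Cell k x y) (g : c ⟶ d) :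
    (φ.whiskerRight g).whiskerLeft f = (ofEq (Strict.assoc _ _ _).symm k).comp
      (((φ.whiskerLeft f).whiskerRight g).comp (ofEq (Strict.assoc _ _ _) k)) := by
  refine ((map_map _ _ φ).trans (map_congr (pre_post_eq f g).symm φ)).trans ?_
  rw [← map_map]; rfl

theorem whiskerLeft_whiskerLeft (f : a ⟶ b) (g : b ⟶ c) {x y : c ⟶ d} (φ : Cell k x y) :
    (φ.whiskerLeft g).whiskerLeft f = (ofEq (Strict.assoc _ _ _).symm k).comp
      ((φ.whiskerLeft (f ≫ g)).comp (ofEq (Strict.assoc _ _ _) k)) := by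
  simp only [whiskerLeft_comp, comp_assoc, ofEq_comp_ofEq_assoc, ofEq_comp_ofEq, ofEq_comp,
    comp_ofEq]

theorem whiskerRight_whiskerRight {x y : a ⟶ b} (φ : Cell k x y) (f : b ⟶ c) (g : c ⟶ d) :
    (φ.whiskerRight f).whiskerRight g = (ofEq (Strict.assoc _ _ _) k).comp
      ((φ.whiskerRight (f ≫ g)).comp (ofEq (Strict.assoc _ _ _).symm k)) := by
  simp only [whiskerRight_comp, comp_assoc, ofEq_comp_ofEq_assoc, ofEq_comp_ofEq, ofEq_comp,
    comp_ofEq]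

theorem whiskerLeft_congr {f f' : a ⟶ b} (h : f = f') {x y : b ⟶ c} (φ : Cell k x y) :
    φ.whiskerLeft f = (ofEq (by rw [h]) k).comp
      ((φ.whiskerLeft f').comp (ofEq (by rw [h]) k)) := by
  subst h; rw [ofEq_comp, comp_ofEq]

theorem whiskerRight_congr {f f' : b ⟶ c} (h : f = f') {x y : a ⟶ b} (φ : Cell k x y) :
    φ.whiskerRight f = (ofEq (by rw [h]) k).comp
      ((φ.whiskerRight f').comp (ofEq (by rw [h]) k)) := by
  subst h; rw [ofEq_comp, comp_ofEq]

theorem id_whiskerLeft {x y : a ⟶ b} (φ : Cell k x y) :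
    φ.whiskerLeft (𝟙 a) = (ofEq (Strict.id_comp _) k).comp
      (φ.comp (ofEq (Strict.id_comp _).symm k)) :=
  (map_congr (precomp_id_eq a b) φ).trans (by rw [map_id]; rfl)

theorem whiskerRight_id {x y : a ⟶ b} (φ : Cell k x y) :
    φ.whiskerRight (𝟙 b) = (ofEq (Strict.comp_id _) k).comp
      (φ.comp (ofEq (Strict.comp_id _).symm k)) :=
  (map_congr (postcomp_id_eq a b) φ).trans (by rw [map_id]; rfl)

theorem whisker_exchange {f g : a ⟶ b} {x y : b ⟶ c} (φ : Cell k f g) (ψ : Cell k x y) :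
    (ψ.whiskerLeft f).comp (φ.whiskerRight y) = (φ.whiskerRight x).comp (ψ.whiskerLeft g) := by
  cases k
  · rfl
  · exact Iso.ext (Bicategory.whisker_exchange (Iso.hom (X := f) (Y := g) φ)
      (Iso.hom (X := x) (Y := y) ψ))
  · exact Bicategory.whisker_exchange (f := f) (g := g) (h := x) (i := y) φ ψ
  · exact (Bicategory.whisker_exchange (f := g) (g := f) (h := y) (i := x) φ ψ).symm

section
variable {C : Type u₁} [Bicategory.{w₁, v₁} C] (T : StrictPseudofunctor B C)

theorem mapCell_whiskerLeft (f : a ⟶ b) {x y : b ⟶ c} (φ : Cell k x y) :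
    (φ.whiskerLeft f).mapCell T = (ofEq (T.map_comp _ _) k).comp
      (((φ.mapCell T).whiskerLeft (T.map f)).comp (ofEq (T.map_comp _ _).symm k)) := by
  refine ((map_map _ _ φ).trans (map_congr (map_precomp_eq T f c) φ)).trans ?_
  rw [← map_map]; rfl

theorem mapCell_whiskerRight {x y : a ⟶ b} (φ : Cell k x y) (f : b ⟶ c) :
    (φ.whiskerRight f).mapCell T = (ofEq (T.map_comp _ _) k).comp
      (((φ.mapCell T).whiskerRight (T.map f)).comp (ofEq (T.map_comp _ _).symm k)) := by
  refine ((map_map _ _ φ).trans (map_congr (map_postcomp_eq T a f) φ)).trans ?_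
  rw [← map_map]; rfl

end

/-- Whiskering by a 2-cell on the other side gives commuting squares. -/
theorem square_whiskerRight {x y : a ⟶ b} (φ : Cell k x y) {f g : b ⟶ c} (α : f ⟶ g) :
    Square (φ.whiskerRight f) (φ.whiskerRight g) (x ◁ α) (y ◁ α) := by
  cases k
  · obtain ⟨⟨rfl⟩⟩ := φ
    simp [Square]
  · exact Bicategory.whisker_exchange (Iso.hom (X := x) (Y := y) φ) α
  · exact Bicategory.whisker_exchange (f := x) (g := y) φ α
  · exact (Bicategory.whisker_exchange (f := y) (g := x) φ α).symm

theorem square_whiskerLeft {f g : a ⟶ b} (α : f ⟶ g) {x y : b ⟶ c} (φ : Cell k x y) :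
    Square (φ.whiskerLeft f) (φ.whiskerLeft g) (α ▷ x) (α ▷ y) := by
  cases k
  · obtain ⟨⟨rfl⟩⟩ := φ
    simp [Square]
  · exact (Bicategory.whisker_exchange α (Iso.hom (X := x) (Y := y) φ)).symm
  · exact (Bicategory.whisker_exchange (h := x) (i := y) α φ).symm
  · exact Bicategory.whisker_exchange (h := y) (i := x) α φ

theorem sq_map_left {C : Type u₁} [Bicategory.{w₁, v₁} C] [Strict C]
    (T : StrictPseudofunctor B C) (f : a ⟶ b) {x y : b ⟶ c} (α : x ⟶ y) {e : C}
    (s : T.obj c ⟶ e) (h₁ : T.map (f ≫ x) ≫ s = T.map f ≫ T.map x ≫ s)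
    (h₂ : T.map (f ≫ y) ≫ s = T.map f ≫ T.map y ≫ s) :
    (T.map₂ (f ◁ α) ▷ s) ≫ eqToHom h₂ = eqToHom h₁ ≫ T.map f ◁ T.map₂ α ▷ s := by
  simp [T.mapComp_eq_eqToIso, Strict.associator_eqToIso]

theorem sq_map_right {C : Type u₁} [Bicategory.{w₁, v₁} C] [Strict C]
    (T : StrictPseudofunctor B C) {x y : a ⟶ b} (α : x ⟶ y) (f : b ⟶ c) {e : C}
    (s : T.obj c ⟶ e) (h₁ : T.map (x ≫ f) ≫ s = T.map x ≫ T.map f ≫ s)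
    (h₂ : T.map (y ≫ f) ≫ s = T.map y ≫ T.map f ≫ s) :
    (T.map₂ (α ▷ f) ▷ s) ≫ eqToHom h₂ = eqToHom h₁ ≫ T.map₂ α ▷ (T.map f ≫ s) := by
  simp [T.mapComp_eq_eqToIso, Strict.associator_eqToIso]

theorem sq_left_left (f : a ⟶ b) (g : b ⟶ c) {x y : c ⟶ d} (α : x ⟶ y)
    (h₁ : f ≫ g ≫ x = (f ≫ g) ≫ x) (h₂ : f ≫ g ≫ y = (f ≫ g) ≫ y) :
    (f ◁ g ◁ α) ≫ eqToHom h₂ = eqToHom h₁ ≫ (f ≫ g) ◁ α := by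
  simp [Strict.associator_eqToIso]

theorem sq_left_right (f : a ⟶ b) {x y : b ⟶ c} (α : x ⟶ y) (g : c ⟶ d)
    (h₁ : (f ≫ x) ≫ g = f ≫ x ≫ g) (h₂ : (f ≫ y) ≫ g = f ≫ y ≫ g) :
    ((f ◁ α) ▷ g) ≫ eqToHom h₂ = eqToHom h₁ ≫ f ◁ (α ▷ g) := by
  simp [Strict.associator_eqToIso]

theorem sq_left_left' (f : a ⟶ b) (g : b ⟶ c) {x y : c ⟶ d} (α : x ⟶ y)
    (h₁ : (f ≫ g) ≫ x = f ≫ g ≫ x) (h₂ : (f ≫ g) ≫ y = f ≫ g ≫ y) :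
    ((f ≫ g) ◁ α) ≫ eqToHom h₂ = eqToHom h₁ ≫ f ◁ g ◁ α := by
  simp [Strict.associator_eqToIso]

theorem sq_right_right {x y : a ⟶ b} (α : x ⟶ y) (f : b ⟶ c) (g : c ⟶ d)
    (h₁ : x ≫ f ≫ g = (x ≫ f) ≫ g) (h₂ : y ≫ f ≫ g = (y ≫ f) ≫ g) :
    (α ▷ (f ≫ g)) ≫ eqToHom h₂ = eqToHom h₁ ≫ (α ▷ f) ▷ g := by
  simp [Strict.associator_eqToIso]

end Weakness.Cell

section Algebras

open Weakness.Cell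

variable {B : Type u} [Bicategory.{w, v} B] [Strict B]

/-- Strict algebras for a 2-monad. -/
structure TwoMonad.Algebra (M : TwoMonad B) where
  obj : B
  str : M.T.obj obj ⟶ obj
  unit : M.η obj ≫ str = 𝟙 obj
  mul : M.μ obj ≫ str = M.T.map str ≫ str

/-- For a weakness `k`, the objects of the 2-category of `M`-algebras and `k`-morphisms:
these are just the strict `M`-algebras. -/
@[nolint unusedArguments]
structure TwoMonad.Alg (M : TwoMonad B) (k : Weakness) where
  alg : M.Algebra

variable {M : TwoMonad B}

namespace TwoMonad.Algebra

theorem unit_nat (X Y : M.Algebra) (f : X.obj ⟶ Y.obj) :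
    M.η X.obj ≫ M.T.map f ≫ Y.str = M.η X.obj ≫ X.str ≫ f := by
  rw [← Strict.assoc, ← M.η_nat, Strict.assoc, Y.unit, ← Strict.assoc, X.unit,
    Strict.id_comp, Strict.comp_id]

theorem mul_left (X Y : M.Algebra) (f : X.obj ⟶ Y.obj) :
    M.μ X.obj ≫ M.T.map f ≫ Y.str = M.T.map (M.T.map f ≫ Y.str) ≫ Y.str := by
  rw [← Strict.assoc, ← M.μ_nat, Strict.assoc, Y.mul, M.T.map_comp, Strict.assoc]

theorem mul_mid (X Y : M.Algebra) (f : X.obj ⟶ Y.obj) :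
    M.T.map (X.str ≫ f) ≫ Y.str = M.T.map X.str ≫ M.T.map f ≫ Y.str := by
  rw [M.T.map_comp, Strict.assoc]

theorem mul_right (X Y : M.Algebra) (f : X.obj ⟶ Y.obj) :
    M.T.map X.str ≫ X.str ≫ f = M.μ X.obj ≫ X.str ≫ f := by
  rw [← Strict.assoc, ← X.mul, Strict.assoc]

end TwoMonad.Algebra

/-- A `k`-morphism of algebras `(A, a) ⇝ (B, b)`: a 1-cell `f : A ⟶ B` and a `k`-cell
`b.Tf → f.a` satisfying the unit and multiplication conditions. -/
structure TwoMonad.AlgHom {M : TwoMonad B} (k : Weakness) (X Y : M.Algebra) where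
  f : X.obj ⟶ Y.obj
  cell : Cell k (M.T.map f ≫ Y.str) (X.str ≫ f)
  unit : cell.whiskerLeft (M.η X.obj) = ofEq (X.unit_nat Y f) k
  mul : cell.whiskerLeft (M.μ X.obj) =
    (ofEq (X.mul_left Y f) k).comp (((cell.mapCell M.T).whiskerRight Y.str).comp
      ((ofEq (X.mul_mid Y f) k).comp ((cell.whiskerLeft (M.T.map X.str)).comp
        (ofEq (X.mul_right Y f) k))))

namespace TwoMonad.AlgHom

variable {k : Weakness} {X Y Z : M.Algebra}

theorem ext' {g h : AlgHom k X Y} (hf : g.f = h.f)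
    (hc : g.cell = (ofEq (by rw [hf]) k).comp (h.cell.comp (ofEq (by rw [hf]) k))) : g = h := by
  obtain ⟨f, c, _, _⟩ := g
  obtain ⟨f', c', _, _⟩ := h
  obtain rfl : f = f' := hf
  rw [ofEq_comp, comp_ofEq] at hc
  obtain rfl : c = c' := hc
  rfl

theorem ext_cell {g h : AlgHom k X Y} (hf : g.f = h.f) (hc : HEq g.cell h.cell) : g = h := by
  obtain ⟨f, c, _, _⟩ := g
  obtain ⟨f', c', _, _⟩ := h
  obtain rfl : f = f' := hf
  obtain rfl : c = c' := eq_of_heq hc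
  rfl

/-- The identity morphism. -/
def id (k : Weakness) (X : M.Algebra) : AlgHom k X X where
  f := 𝟙 X.obj
  cell := ofEq (by rw [M.T.map_id, Strict.id_comp, Strict.comp_id]) k
  unit := whiskerLeft_ofEq _ _
  mul := by
    simp only [mapCell_ofEq, whiskerLeft_ofEq, whiskerRight_ofEq, ofEq_comp_ofEq]

theorem comp_h₁ (g : AlgHom k X Y) (h : AlgHom k Y Z) :
    M.T.map (g.f ≫ h.f) ≫ Z.str = M.T.map g.f ≫ M.T.map h.f ≫ Z.str := by
  rw [M.T.map_comp, Strict.assoc]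

/-- Composition of `k`-morphisms: `c.Tg.Tf → g.b.Tf → g.f.a`. -/
def comp (g : AlgHom k X Y) (h : AlgHom k Y Z) : AlgHom k X Z where
  f := g.f ≫ h.f
  cell := (ofEq (comp_h₁ g h) k).comp
    ((h.cell.whiskerLeft (M.T.map g.f)).comp
      ((ofEq (Strict.assoc _ _ _).symm k).comp
        ((g.cell.whiskerRight h.f).comp (ofEq (Strict.assoc _ _ _) k))))
  unit := by
    simp only [whiskerLeft_vcomp, whiskerLeft_ofEq]
    rw [whiskerLeft_whiskerLeft, whiskerLeft_congr (M.η_nat g.f).symm, Cell.whiskerLeft_comp, h.unit,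
      whiskerLeft_whiskerRight, g.unit]
    simp only [whiskerLeft_ofEq, whiskerRight_ofEq, ofEq_comp_ofEq]
  mul := by
    simp only [whiskerLeft_vcomp, whiskerLeft_ofEq, mapCell_vcomp, mapCell_ofEq,
      whiskerRight_vcomp, whiskerRight_ofEq]
    rw [whiskerLeft_whiskerLeft, whiskerLeft_congr (M.μ_nat g.f).symm, Cell.whiskerLeft_comp, h.mul,
      whiskerLeft_whiskerRight, g.mul, mapCell_whiskerLeft, mapCell_whiskerRight]
    simp only [whiskerLeft_vcomp, whiskerLeft_ofEq, whiskerRight_vcomp, whiskerRight_ofEq,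
      comp_assoc, ofEq_comp_ofEq_assoc, ofEq_comp_ofEq]
    rw [whiskerLeft_whiskerRight (M.T.map (M.T.map g.f)) (h.cell.mapCell M.T) Z.str,
      whiskerLeft_whiskerRight (M.T.map X.str) g.cell h.f,
      whiskerLeft_whiskerLeft (M.T.map (M.T.map g.f)) (M.T.map Y.str) h.cell,
      whiskerLeft_whiskerLeft (M.T.map X.str) (M.T.map g.f) h.cell,
      whiskerLeft_congr (M.T.map_comp (M.T.map g.f) Y.str).symm h.cell,
      whiskerLeft_congr (M.T.map_comp X.str g.f).symm h.cell,
      whiskerRight_whiskerRight (g.cell.mapCell M.T) Y.str h.f,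
      whiskerRight_whiskerRight (g.cell.mapCell M.T) (M.T.map h.f) Z.str]
    have ex := Cell.whisker_exchange (g.cell.mapCell M.T) h.cell
    simp only [comp_assoc, ofEq_comp_ofEq_assoc, ofEq_comp_ofEq, ofEq_comp]
    rw [← comp_assoc (h.cell.whiskerLeft _), ex]
    simp only [comp_assoc]

/-- 2-cells between `k`-morphisms of algebras. -/
@[ext]
structure Hom₂ (g h : AlgHom k X Y) where
  hom : g.f ⟶ h.f
  square : Square g.cell h.cell (M.T.map₂ hom ▷ Y.str) (X.str ◁ hom)

/-- A `k₁`-morphism regarded as a `k₂`-morphism when `k₁ ≤ k₂`. -/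
def incl {k₁ k₂ : Weakness} (hk : Le k₁ k₂) (g : AlgHom k₁ X Y) : AlgHom k₂ X Y where
  f := g.f
  cell := g.cell.incl hk
  unit := by rw [← incl_whiskerLeft, g.unit, incl_ofEq]
  mul := by
    rw [← incl_whiskerLeft, g.mul]
    simp only [incl_comp, incl_ofEq, incl_whiskerLeft, incl_whiskerRight, incl_mapCell]

/-- A 2-cell between `k₁`-morphisms regarded as one between `k₂`-morphisms. -/
def Hom₂.incl {k₁ k₂ : Weakness} (hk : Le k₁ k₂) {g h : AlgHom k₁ X Y} (α : Hom₂ g h) :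
    Hom₂ (g.incl hk) (h.incl hk) :=
  ⟨α.hom, α.square.incl hk⟩

end TwoMonad.AlgHom

namespace TwoMonad

variable {k : Weakness}

instance (M : TwoMonad B) (k : Weakness) : CategoryStruct (M.Alg k) where
  Hom X Y := AlgHom k X.alg Y.alg
  id X := AlgHom.id k X.alg
  comp g h := AlgHom.comp g h

instance (M : TwoMonad B) (k : Weakness) (X Y : M.Alg k) : Category (X ⟶ Y) where
  Hom g h := AlgHom.Hom₂ g h
  id g := ⟨𝟙 g.f, by
    have h := Square.refl g.cell
    rwa [← Bicategory.id_whiskerRight, ← M.T.map₂_id, ← Bicategory.whiskerLeft_id] at h⟩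
  comp α β := ⟨α.hom ≫ β.hom, by
    have h := α.square.vcomp β.square
    rwa [← Bicategory.comp_whiskerRight, ← M.T.map₂_comp, ← Bicategory.whiskerLeft_comp] at h⟩
  id_comp _ := AlgHom.Hom₂.ext (Category.id_comp _)
  comp_id _ := AlgHom.Hom₂.ext (Category.comp_id _)
  assoc _ _ _ := AlgHom.Hom₂.ext (Category.assoc _ _ _)

theorem AlgHom.id_comp' {X Y : M.Algebra} (g : AlgHom k X Y) :
    AlgHom.comp (AlgHom.id k X) g = g :=
  AlgHom.ext' (Strict.id_comp _) (by
    simp only [AlgHom.comp, AlgHom.id]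
    rw [whiskerRight_ofEq, whiskerLeft_congr (M.T.map_id X.obj) g.cell, Cell.id_whiskerLeft]
    simp only [comp_assoc, ofEq_comp_ofEq_assoc, ofEq_comp_ofEq])

theorem AlgHom.comp_id' {X Y : M.Algebra} (g : AlgHom k X Y) :
    AlgHom.comp g (AlgHom.id k Y) = g :=
  AlgHom.ext' (Strict.comp_id _) (by
    simp only [AlgHom.comp, AlgHom.id]
    rw [whiskerLeft_ofEq, Cell.whiskerRight_id]
    simp only [comp_assoc, ofEq_comp_ofEq_assoc, ofEq_comp_ofEq])

theorem AlgHom.assoc' {X Y Z W : M.Algebra} (g : AlgHom k X Y) (h : AlgHom k Y Z)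
    (i : AlgHom k Z W) : (g.comp h).comp i = g.comp (h.comp i) :=
  AlgHom.ext' (Strict.assoc _ _ _) (by
    dsimp only [AlgHom.comp]
    simp only [whiskerLeft_vcomp, whiskerRight_vcomp, whiskerLeft_ofEq,
      whiskerRight_ofEq]
    rw [whiskerLeft_congr (M.T.map_comp g.f h.f) i.cell, Cell.whiskerLeft_comp,
      whiskerLeft_whiskerRight, whiskerRight_whiskerRight g.cell h.f i.f]
    simp only [comp_assoc, ofEq_comp_ofEq_assoc, ofEq_comp_ofEq]
    erw [ofEq_comp_ofEq_assoc, ofEq_comp_ofEq])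

theorem AlgHom.square_whiskerLeft {X Y Z : M.Algebra} (g : AlgHom k X Y) {h h' : AlgHom k Y Z}
    (α : AlgHom.Hom₂ h h') : Square (g.comp h).cell (g.comp h').cell
      (M.T.map₂ (g.f ◁ α.hom) ▷ Z.str) (X.str ◁ g.f ◁ α.hom) := by
  refine Square.hcomp (β := M.T.map g.f ◁ (M.T.map₂ α.hom ▷ Z.str))
    (square_ofEq _ _ (sq_map_left M.T _ _ _ _ _)) ?_
  refine Square.hcomp (β := M.T.map g.f ◁ Y.str ◁ α.hom) (α.square.map (precomp _ _)) ?_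
  refine Square.hcomp (β := (M.T.map g.f ≫ Y.str) ◁ α.hom)
    (square_ofEq _ _ (sq_left_left _ _ _ _ _)) ?_
  exact Square.hcomp (β := (X.str ≫ g.f) ◁ α.hom) (Cell.square_whiskerRight _ _)
    (square_ofEq _ _ (sq_left_left' _ _ _ _ _))

theorem AlgHom.square_whiskerRight {X Y Z : M.Algebra} {g g' : AlgHom k X Y}
    (α : AlgHom.Hom₂ g g') (h : AlgHom k Y Z) : Square (g.comp h).cell (g'.comp h).cell
      (M.T.map₂ (α.hom ▷ h.f) ▷ Z.str) (X.str ◁ α.hom ▷ h.f) := by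
  refine Square.hcomp (β := M.T.map₂ α.hom ▷ (M.T.map h.f ≫ Z.str))
    (square_ofEq _ _ (sq_map_right M.T _ _ _ _ _)) ?_
  refine Square.hcomp (β := M.T.map₂ α.hom ▷ (Y.str ≫ h.f)) (Cell.square_whiskerLeft _ _) ?_
  refine Square.hcomp (β := (M.T.map₂ α.hom ▷ Y.str) ▷ h.f)
    (square_ofEq _ _ (sq_right_right _ _ _ _ _)) ?_
  exact Square.hcomp (β := (X.str ◁ α.hom) ▷ h.f) (α.square.map (postcomp _ _))
    (square_ofEq _ _ (sq_left_right _ _ _ _ _))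

theorem AlgHom.eqToHom_hom {X Y : M.Alg k} {g h : X ⟶ Y} (e : g = h) :
    AlgHom.Hom₂.hom (eqToHom e) = eqToHom (congrArg AlgHom.f e) := by
  subst e; rfl

def AlgHom.whiskerLeft {X Y Z : M.Algebra} (g : AlgHom k X Y) {h h' : AlgHom k Y Z}
    (α : AlgHom.Hom₂ h h') : AlgHom.Hom₂ (g.comp h) (g.comp h') :=
  ⟨g.f ◁ α.hom, AlgHom.square_whiskerLeft g α⟩

def AlgHom.whiskerRight {X Y Z : M.Algebra} {g g' : AlgHom k X Y}
    (α : AlgHom.Hom₂ g g') (h : AlgHom k Y Z) : AlgHom.Hom₂ (g.comp h) (g'.comp h) :=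
  ⟨α.hom ▷ h.f, AlgHom.square_whiskerRight α h⟩

section
variable {X Y : M.Alg k}

@[ext]
theorem Alg.hom₂_ext {g h : X ⟶ Y} {α β : g ⟶ h}
    (e : AlgHom.Hom₂.hom α = AlgHom.Hom₂.hom β) : α = β := AlgHom.Hom₂.ext e

theorem Alg.id_hom (g : X ⟶ Y) : AlgHom.Hom₂.hom (𝟙 g) = 𝟙 (AlgHom.f g) := rfl

theorem Alg.comp_hom {g h i : X ⟶ Y} (α : g ⟶ h) (β : h ⟶ i) :
    AlgHom.Hom₂.hom (α ≫ β) = AlgHom.Hom₂.hom α ≫ AlgHom.Hom₂.hom β := rfl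

theorem Alg.conj_hom {g h g' h' : X ⟶ Y} (e : g = g') (α : g' ⟶ h') (e' : h' = h) :
    AlgHom.Hom₂.hom (eqToHom e ≫ α ≫ eqToHom e') = eqToHom (congrArg AlgHom.f e) ≫
      AlgHom.Hom₂.hom α ≫ eqToHom (congrArg AlgHom.f e') := by
  subst e e'; rfl

end

/-- The 2-category of `M`-algebras, `k`-morphisms and algebra 2-cells. -/
instance (M : TwoMonad B) (k : Weakness) : Bicategory (M.Alg k) where
  whiskerLeft g _ _ α := AlgHom.whiskerLeft g α
  whiskerRight α h := AlgHom.whiskerRight α h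
  associator g h i := eqToIso (AlgHom.assoc' g h i)
  leftUnitor g := eqToIso (AlgHom.id_comp' g)
  rightUnitor g := eqToIso (AlgHom.comp_id' g)
  whiskerLeft_id _ _ := Alg.hom₂_ext (Bicategory.whiskerLeft_id _ _)
  whiskerLeft_comp _ _ _ _ _ _ := Alg.hom₂_ext (Bicategory.whiskerLeft_comp _ _ _)
  id_whiskerLeft α := by
    refine Alg.hom₂_ext ?_
    simp only [Alg.comp_hom, eqToIso.hom, eqToIso.inv, AlgHom.eqToHom_hom]
    exact (Bicategory.id_whiskerLeft _).trans (by simp only [Strict.leftUnitor_eqToIso]; rfl)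
  comp_whiskerLeft f g _ _ α := by
    refine Alg.hom₂_ext ?_
    simp only [Alg.comp_hom, eqToIso.hom, eqToIso.inv, AlgHom.eqToHom_hom]
    refine (Bicategory.comp_whiskerLeft _ _ _).trans ?_
    simp only [Strict.associator_eqToIso]; rfl
  id_whiskerRight _ _ := Alg.hom₂_ext (Bicategory.id_whiskerRight _ _)
  comp_whiskerRight _ _ _ := Alg.hom₂_ext (Bicategory.comp_whiskerRight _ _ _)
  whiskerRight_id α := by
    refine Alg.hom₂_ext ?_
    simp only [Alg.comp_hom, eqToIso.hom, eqToIso.inv, AlgHom.eqToHom_hom]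
    refine (Bicategory.whiskerRight_id _).trans ?_
    simp only [Strict.rightUnitor_eqToIso]; rfl
  whiskerRight_comp α _ _ := by
    refine Alg.hom₂_ext ?_
    simp only [Alg.comp_hom, eqToIso.hom, eqToIso.inv, AlgHom.eqToHom_hom]
    refine (Bicategory.whiskerRight_comp _ _ _).trans ?_
    simp only [Strict.associator_eqToIso]; rfl
  whisker_assoc f _ _ α g := by
    refine Alg.hom₂_ext ?_
    simp only [Alg.comp_hom, eqToIso.hom, eqToIso.inv, AlgHom.eqToHom_hom]
    refine (Bicategory.whisker_assoc _ _ _).trans ?_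
    simp only [Strict.associator_eqToIso]; rfl
  whisker_exchange _ _ := Alg.hom₂_ext (Bicategory.whisker_exchange _ _)
  pentagon f g h i := by
    refine Alg.hom₂_ext ?_
    simp only [Alg.comp_hom, eqToIso.hom, AlgHom.eqToHom_hom]
    refine Eq.trans ?_ ((Bicategory.pentagon (AlgHom.f f) (AlgHom.f g) (AlgHom.f h)
      (AlgHom.f i)).trans ?_)
    all_goals
      simp only [Strict.associator_eqToIso]
      simp only [AlgHom.whiskerRight, AlgHom.whiskerLeft, eqToIso.hom, AlgHom.eqToHom_hom]
      rfl
  triangle f g := by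
    refine Alg.hom₂_ext ?_
    simp only [Alg.comp_hom, eqToIso.hom, AlgHom.eqToHom_hom]
    refine Eq.trans ?_ ((Bicategory.triangle (AlgHom.f f) (AlgHom.f g)).trans ?_)
    all_goals
      simp only [Strict.associator_eqToIso, Strict.leftUnitor_eqToIso,
        Strict.rightUnitor_eqToIso]
      simp only [AlgHom.whiskerRight, AlgHom.whiskerLeft, eqToIso.hom, AlgHom.eqToHom_hom]
      rfl

instance (M : TwoMonad B) (k : Weakness) : Strict (M.Alg k) where
  id_comp g := AlgHom.id_comp' g
  comp_id g := AlgHom.comp_id' g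
  assoc g h i := AlgHom.assoc' g h i
  leftUnitor_eqToIso _ := rfl
  rightUnitor_eqToIso _ := rfl
  associator_eqToIso _ _ _ := rfl

/-- The forgetful 2-functor. -/
def forget (M : TwoMonad B) (k : Weakness) : StrictPseudofunctor (M.Alg k) B :=
  StrictPseudofunctor.mk''
    { obj := fun X => X.alg.obj
      map := fun g => AlgHom.f g
      map₂ := fun α => AlgHom.Hom₂.hom α
      map₂_id := fun _ => rfl
      map₂_comp := fun _ _ => rfl
      map_id := fun _ => rfl
      map_comp := fun _ _ => rfl
      map₂_whisker_left := fun _ _ _ _ => ((Category.id_comp _).trans (Category.comp_id _)).symm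
      map₂_whisker_right := fun _ _ => ((Category.id_comp _).trans (Category.comp_id _)).symm }

theorem AlgHom.incl_id {k₁ k₂ : Weakness} (hk : Le k₁ k₂) (X : M.Algebra) :
    (AlgHom.id k₁ X).incl hk = AlgHom.id k₂ X :=
  AlgHom.ext_cell rfl (heq_of_eq (incl_ofEq _ _))

theorem AlgHom.incl_comp {k₁ k₂ : Weakness} (hk : Le k₁ k₂) {X Y Z : M.Algebra}
    (g : AlgHom k₁ X Y) (h : AlgHom k₁ Y Z) :
    (g.comp h).incl hk = (g.incl hk).comp (h.incl hk) :=
  AlgHom.ext_cell rfl (heq_of_eq (by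
    simp only [AlgHom.incl, AlgHom.comp, Cell.incl_comp, incl_whiskerLeft, incl_whiskerRight,
      incl_ofEq]))

/-- The inclusion 2-functor from `k₁`-morphisms to `k₂`-morphisms, when `k₁ ≤ k₂`; it is the
identity on objects and on 2-cells. -/
def inclusion (M : TwoMonad B) {k₁ k₂ : Weakness} (hk : Le k₁ k₂) :
    StrictPseudofunctor (M.Alg k₁) (M.Alg k₂) :=
  StrictPseudofunctor.mk''
    { obj := fun X => ⟨X.alg⟩
      map := fun g => AlgHom.incl hk g
      map₂ := fun α => AlgHom.Hom₂.incl hk α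
      map₂_id := fun _ => rfl
      map₂_comp := fun _ _ => rfl
      map_id := fun X => AlgHom.incl_id hk X.alg
      map_comp := fun g h => AlgHom.incl_comp hk g h
      map₂_whisker_left := fun _ _ _ _ => by
        refine Alg.hom₂_ext (Eq.trans ?_ (Alg.conj_hom _ _ _).symm)
        exact ((Category.id_comp _).trans (Category.comp_id _)).symm
      map₂_whisker_right := fun _ _ => by
        refine Alg.hom₂_ext (Eq.trans ?_ (Alg.conj_hom _ _ _).symm)
        exact ((Category.id_comp _).trans (Category.comp_id _)).symm }

end TwoMonad

end Algebras

section Comparison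

open Weakness.Cell

variable {A : Type u} [Bicategory.{w, v} A] [Strict A] {B : Type u₁} [Bicategory.{w₁, v₁} B]
  [Strict B] {F : StrictPseudofunctor B A} {G : StrictPseudofunctor A B}

namespace TwoAdjunction

/-- The strict algebra `(Ga, Gε_a)`. -/
def algebra (adj : TwoAdjunction F G) (a : A) : adj.toTwoMonad.Algebra where
  obj := G.obj a
  str := G.map (adj.counit a)
  unit := adj.right_triangle a
  mul := by
    have h := congrArg G.map (adj.counit_nat (adj.counit a))
    rw [G.map_comp, G.map_comp] at h
    exact h.symm

/-- The strict morphism of algebras `Gf`. -/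
def algHom (adj : TwoAdjunction F G) {a b : A} (f : a ⟶ b) :
    TwoMonad.AlgHom .s (adj.algebra a) (adj.algebra b) where
  f := G.map f
  cell := ofEq (by
    have h := congrArg G.map (adj.counit_nat f)
    rw [G.map_comp, G.map_comp] at h
    exact h) .s
  unit := rfl
  mul := rfl

/-- The algebra 2-cell `Gα`. -/
def algHom₂ (adj : TwoAdjunction F G) {a b : A} {f g : a ⟶ b} (α : f ⟶ g) :
    TwoMonad.AlgHom.Hom₂ (adj.algHom f) (adj.algHom g) where
  hom := G.map₂ α
  square := by
    have h := congrArg (fun x => G.map₂ x) (adj.counit_nat₂ α)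
    simp only [PrelaxFunctor.map₂_comp, PrelaxFunctor.map₂_eqToHom,
      Pseudofunctor.map₂_whisker_left, Pseudofunctor.map₂_whisker_right,
      StrictPseudofunctor.mapComp_eq_eqToIso] at h
    simp only [Category.assoc, eqToHom_trans, eqToHom_trans_assoc, eqToIso.hom,
      eqToIso.inv] at h
    exact eqToHom_conj h _ _

/-- The Eilenberg–Moore comparison 2-functor `E : A ⥤ T-Alg_s` of a 2-adjunction. -/
def comparison (adj : TwoAdjunction F G) :
    StrictPseudofunctor A (adj.toTwoMonad.Alg .s) :=
  StrictPseudofunctor.mk''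
    { obj := fun a => ⟨adj.algebra a⟩
      map := fun f => adj.algHom f
      map₂ := fun α => adj.algHom₂ α
      map₂_id := fun f => TwoMonad.Alg.hom₂_ext (G.map₂_id f)
      map₂_comp := fun α β => TwoMonad.Alg.hom₂_ext (G.map₂_comp α β)
      map_id := fun a => TwoMonad.AlgHom.ext' (G.map_id a) rfl
      map_comp := fun f g => TwoMonad.AlgHom.ext' (G.map_comp f g) rfl
      map₂_whisker_left := fun f _ _ η => by
        refine TwoMonad.Alg.hom₂_ext (Eq.trans ?_ (TwoMonad.Alg.conj_hom _ _ _).symm)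
        refine (G.map₂_whisker_left f η).trans ?_
        simp only [StrictPseudofunctor.mapComp_eq_eqToIso]
        rfl
      map₂_whisker_right := fun η f => by
        refine TwoMonad.Alg.hom₂_ext (Eq.trans ?_ (TwoMonad.Alg.conj_hom _ _ _).symm)
        refine (G.map₂_whisker_right η f).trans ?_
        simp only [StrictPseudofunctor.mapComp_eq_eqToIso]
        rfl }

end TwoAdjunction

end Comparison

/-- A wide subcategory of the underlying category of a 2-category: a class of 1-cells containing
the identities and closed under composition. -/
structure WideSubcat (A : Type u) [Bicategory.{w, v} A] where
  mem : ∀ ⦃a b : A⦄, (a ⟶ b) → Prop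
  id_mem : ∀ a : A, mem (𝟙 a)
  comp_mem : ∀ ⦃a b c : A⦄ (f : a ⟶ b) (g : b ⟶ c), mem f → mem g → mem (f ≫ g)

namespace WideSubcat

variable {A : Type u} [Bicategory.{w, v} A]

/-- The objects of the locally full sub-2-category on a wide subcategory of 1-cells. -/
@[nolint unusedArguments]
structure Sub (P : WideSubcat A) where
  obj : A

/-- Its 1-cells. -/
@[ext]
structure Sub.Hom {P : WideSubcat A} (a b : P.Sub) where
  hom : a.obj ⟶ b.obj
  mem : P.mem hom

/-- Its 2-cells: all 2-cells of `A`. -/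
@[ext]
structure Sub.Hom₂ {P : WideSubcat A} {a b : P.Sub} (f g : Sub.Hom a b) where
  hom : f.hom ⟶ g.hom

variable {P Q : WideSubcat A}

instance : CategoryStruct P.Sub where
  Hom a b := Sub.Hom a b
  id a := ⟨𝟙 a.obj, P.id_mem _⟩
  comp f g := ⟨f.hom ≫ g.hom, P.comp_mem _ _ f.mem g.mem⟩

instance (a b : P.Sub) : Category (a ⟶ b) where
  Hom f g := Sub.Hom₂ f g
  id f := ⟨𝟙 f.hom⟩
  comp α β := ⟨α.hom ≫ β.hom⟩
  id_comp _ := Sub.Hom₂.ext (Category.id_comp _)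
  comp_id _ := Sub.Hom₂.ext (Category.comp_id _)
  assoc _ _ _ := Sub.Hom₂.ext (Category.assoc _ _ _)

@[ext]
theorem Sub.hom₂_ext {a b : P.Sub} {f g : a ⟶ b} {α β : f ⟶ g}
    (e : Sub.Hom₂.hom α = Sub.Hom₂.hom β) : α = β := Sub.Hom₂.ext e

/-- An invertible 2-cell of `A` between 1-cells of the sub-2-category. -/
def Sub.isoMk {a b : P.Sub} {f g : a ⟶ b} (e : Sub.Hom.hom f ≅ Sub.Hom.hom g) : f ≅ g where
  hom := ⟨e.hom⟩
  inv := ⟨e.inv⟩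
  hom_inv_id := Sub.hom₂_ext e.hom_inv_id
  inv_hom_id := Sub.hom₂_ext e.inv_hom_id

instance : Bicategory P.Sub where
  whiskerLeft f _ _ α := Sub.Hom₂.mk (Sub.Hom.hom f ◁ Sub.Hom₂.hom α)
  whiskerRight α f := Sub.Hom₂.mk (Sub.Hom₂.hom α ▷ Sub.Hom.hom f)
  associator f g h := Sub.isoMk (α_ f.hom g.hom h.hom)
  leftUnitor f := Sub.isoMk (λ_ f.hom)
  rightUnitor f := Sub.isoMk (ρ_ f.hom)
  whiskerLeft_id _ _ := Sub.hom₂_ext (Bicategory.whiskerLeft_id _ _)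
  whiskerLeft_comp _ _ _ _ _ _ := Sub.hom₂_ext (Bicategory.whiskerLeft_comp _ _ _)
  id_whiskerLeft _ := Sub.hom₂_ext (Bicategory.id_whiskerLeft _)
  comp_whiskerLeft _ _ _ _ _ := Sub.hom₂_ext (Bicategory.comp_whiskerLeft _ _ _)
  id_whiskerRight _ _ := Sub.hom₂_ext (Bicategory.id_whiskerRight _ _)
  comp_whiskerRight _ _ _ := Sub.hom₂_ext (Bicategory.comp_whiskerRight _ _ _)
  whiskerRight_id _ := Sub.hom₂_ext (Bicategory.whiskerRight_id _)
  whiskerRight_comp _ _ _ := Sub.hom₂_ext (Bicategory.whiskerRight_comp _ _ _)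
  whisker_assoc _ _ _ _ _ := Sub.hom₂_ext (Bicategory.whisker_assoc _ _ _)
  whisker_exchange _ _ := Sub.hom₂_ext (Bicategory.whisker_exchange _ _)
  pentagon _ _ _ _ := Sub.hom₂_ext (Bicategory.pentagon _ _ _ _)
  triangle _ _ := Sub.hom₂_ext (Bicategory.triangle _ _)

theorem Sub.eqToHom_hom {a b : P.Sub} {f g : a ⟶ b} (e : f = g) :
    Sub.Hom₂.hom (eqToHom e) = eqToHom (congrArg Sub.Hom.hom e) := by
  subst e; rfl

theorem Sub.conj_hom {a b : P.Sub} {g h g' h' : a ⟶ b} (e : g = g') (α : g' ⟶ h')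
    (e' : h' = h) : Sub.Hom₂.hom (eqToHom e ≫ α ≫ eqToHom e') =
      eqToHom (congrArg Sub.Hom.hom e) ≫ Sub.Hom₂.hom α ≫ eqToHom (congrArg Sub.Hom.hom e') := by
  subst e e'; rfl

instance [Strict A] : Strict P.Sub where
  id_comp f := Sub.Hom.ext (Strict.id_comp (Sub.Hom.hom f))
  comp_id f := Sub.Hom.ext (Strict.comp_id (Sub.Hom.hom f))
  assoc f g h := Sub.Hom.ext (Strict.assoc (Sub.Hom.hom f) (Sub.Hom.hom g) (Sub.Hom.hom h))
  leftUnitor_eqToIso f := Iso.ext (by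
    refine Sub.hom₂_ext ?_
    rw [eqToIso.hom, Sub.eqToHom_hom]
    exact congrArg Iso.hom (Strict.leftUnitor_eqToIso (Sub.Hom.hom f)))
  rightUnitor_eqToIso f := Iso.ext (by
    refine Sub.hom₂_ext ?_
    rw [eqToIso.hom, Sub.eqToHom_hom]
    exact congrArg Iso.hom (Strict.rightUnitor_eqToIso (Sub.Hom.hom f)))
  associator_eqToIso f g h := Iso.ext (by
    refine Sub.hom₂_ext ?_
    rw [eqToIso.hom, Sub.eqToHom_hom]
    exact congrArg Iso.hom (Strict.associator_eqToIso (Sub.Hom.hom f) (Sub.Hom.hom g) (Sub.Hom.hom h)))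

variable [Strict A]

/-- The inclusion into the ambient 2-category. -/
def Sub.forget (P : WideSubcat A) : StrictPseudofunctor P.Sub A :=
  StrictPseudofunctor.mk''
    { obj := fun a => a.obj
      map := fun f => (Sub.Hom.hom f)
      map₂ := fun α => Sub.Hom₂.hom α
      map₂_id := fun _ => rfl
      map₂_comp := fun _ _ => rfl
      map_id := fun _ => rfl
      map_comp := fun _ _ => rfl
      map₂_whisker_left := fun _ _ _ _ =>
        ((Category.id_comp _).trans (Category.comp_id _)).symm
      map₂_whisker_right := fun _ _ =>
        ((Category.id_comp _).trans (Category.comp_id _)).symm }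

/-- The inclusion between locally full sub-2-categories. -/
def Sub.incl (h : ∀ ⦃a b : A⦄ (f : a ⟶ b), P.mem f → Q.mem f) :
    StrictPseudofunctor P.Sub Q.Sub :=
  StrictPseudofunctor.mk''
    { obj := fun a => ⟨a.obj⟩
      map := fun f => Sub.Hom.mk (P := Q) (Sub.Hom.hom (P := P) f) (h _ (Sub.Hom.mem f))
      map₂ := fun α => Sub.Hom₂.mk (P := Q) (Sub.Hom₂.hom (P := P) α)
      map₂_id := fun _ => rfl
      map₂_comp := fun _ _ => rfl
      map_id := fun _ => rfl
      map_comp := fun _ _ => rfl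
      map₂_whisker_left := fun _ _ _ _ => by
        refine Sub.hom₂_ext (Eq.trans ?_ (Sub.conj_hom _ _ _).symm)
        exact ((Category.id_comp _).trans (Category.comp_id _)).symm
      map₂_whisker_right := fun _ _ => by
        refine Sub.hom₂_ext (Eq.trans ?_ (Sub.conj_hom _ _ _).symm)
        exact ((Category.id_comp _).trans (Category.comp_id _)).symm }

end WideSubcat

/-- An `F`-category: a 2-category (whose 1-cells are called loose) with a wide subcategory of
tight 1-cells. -/
structure FCat where
  carrier : Type u
  [bicategory : Bicategory.{w, v} carrier]
  [strict : Strict carrier]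
  tight : WideSubcat carrier

attribute [instance] FCat.bicategory FCat.strict

/-- A 2-category regarded as an `F`-category in which all 1-cells are tight. -/
abbrev FCat.of (B : Type u) [Bicategory.{w, v} B] [Strict B] : FCat.{w, v, u} where
  carrier := B
  tight :=
    { mem := fun _ _ _ => True
      id_mem := fun _ => trivial
      comp_mem := fun _ _ _ _ _ _ _ => trivial }

/-- An `F`-functor: a 2-functor preserving tightness. -/
structure FFunctor (𝔸 : FCat.{w, v, u}) (𝔹 : FCat.{w₁, v₁, u₁}) extends
    StrictPseudofunctor 𝔸.carrier 𝔹.carrier where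
  map_tight : ∀ {a b : 𝔸.carrier} (f : a ⟶ b), 𝔸.tight.mem f → 𝔹.tight.mem (map f)

/-- Composition of `F`-functors. -/
def FFunctor.comp {𝔸 : FCat.{w, v, u}} {𝔹 : FCat.{w₁, v₁, u₁}} {𝔻 : FCat.{w₂, v₂, u₂}}
    (G : FFunctor 𝔸 𝔹) (H : FFunctor 𝔹 𝔻) : FFunctor 𝔸 𝔻 where
  toStrictPseudofunctor := G.toStrictPseudofunctor.comp H.toStrictPseudofunctor
  map_tight f hf := H.map_tight _ (G.map_tight f hf)

/-- A 2-functor regarded as an `F`-functor between 2-categories. -/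
def FFunctor.of {A : Type u} [Bicategory.{w, v} A] [Strict A] {B : Type u₁}
    [Bicategory.{w₁, v₁} B] [Strict B] (G : StrictPseudofunctor A B) :
    FFunctor (FCat.of A) (FCat.of B) where
  toStrictPseudofunctor := G
  map_tight _ _ := trivial

section Limits

open Weakness.Cell

namespace FCat

variable (𝔸 : FCat.{w, v, u}) (k : Weakness)

/-- For a loose 1-cell `f : a ⇝ b`, a cone with vertex `x`: loose `r : x ⇝ a`, `s : x ⇝ b` and
a `k`-cell `α : s → f.r`. For `k = l` this is a colax cone `s ⇒ f.r`, for `k = p` a pseudo-cone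
`s ≅ f.r`, and for `k = c` a lax cone `f.r ⇒ s`. -/
structure BarCone {𝔸 : FCat.{w, v, u}} (k : Weakness) {a b : 𝔸.carrier} (f : a ⟶ b)
    (x : 𝔸.carrier) where
  r : x ⟶ a
  s : x ⟶ b
  α : Cell k s (r ≫ f)

variable {𝔸 k}

/-- Restriction of a cone along a loose 1-cell. -/
def BarCone.precomp {a b : 𝔸.carrier} {f : a ⟶ b} {x y : 𝔸.carrier} (C : BarCone k f x)
    (t : y ⟶ x) : BarCone k f y where
  r := t ≫ C.r
  s := t ≫ C.s
  α := (C.α.whiskerLeft t).comp (ofEq (Strict.assoc _ _ _).symm k)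

/-- The universal property of the `k̄`-limit of a loose 1-cell (`l̄ = ` colax, `p̄ = ` pseudo,
`c̄ = ` lax) in the `F`-categorical sense. -/
structure BarCone.IsLimit {a b : 𝔸.carrier} {f : a ⟶ b} {x : 𝔸.carrier}
    (C : BarCone k f x) : Prop where
  tight_r : 𝔸.tight.mem C.r
  tight_s : 𝔸.tight.mem C.s
  /-- Every cone factors uniquely. -/
  existsUnique_lift : ∀ (y : 𝔸.carrier) (D : BarCone k f y), ∃! t : y ⟶ x, C.precomp t = D
  /-- Every morphism between induced cones is induced by a unique 2-cell. -/
  existsUnique_lift₂ : ∀ (y : 𝔸.carrier) (t t' : y ⟶ x) (θr : t ≫ C.r ⟶ t' ≫ C.r)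
    (θs : t ≫ C.s ⟶ t' ≫ C.s),
    Square (C.precomp t).α (C.precomp t').α θs (θr ▷ f) →
      ∃! φ : t ⟶ t', φ ▷ C.r = θr ∧ φ ▷ C.s = θs
  /-- The projections jointly detect tightness. -/
  tight_iff : ∀ (y : 𝔸.carrier) (t : y ⟶ x),
    𝔸.tight.mem t ↔ 𝔸.tight.mem (t ≫ C.r) ∧ 𝔸.tight.mem (t ≫ C.s)

/-- The `F`-category admits `k̄`-limits of loose morphisms. -/
def HasBarLimits (𝔸 : FCat.{w, v, u}) (k : Weakness) : Prop :=
  ∀ (a b : 𝔸.carrier) (f : a ⟶ b), ∃ (x : 𝔸.carrier) (C : BarCone k f x), C.IsLimit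

end FCat

end Limits

section AlgebraFCat

open Weakness.Cell

variable {B : Type u} [Bicategory.{w, v} B] [Strict B]

namespace TwoMonad

theorem AlgHom.incl_incl_s {M : TwoMonad B} {k₁ k₂ : Weakness} (hk : Le k₁ k₂) {X Y : M.Algebra}
    (g : AlgHom .s X Y) : (g.incl (s_le k₁)).incl hk = g.incl (s_le k₂) :=
  AlgHom.ext_cell rfl (heq_of_eq (incl_ofEq hk _))

/-- The `F`-category of algebras whose tight 1-cells are the strict morphisms and whose loose
1-cells are the `k`-morphisms. -/
abbrev algF (M : TwoMonad B) (k : Weakness) : FCat where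
  carrier := M.Alg k
  tight :=
    { mem := fun X Y g => ∃ g₀ : AlgHom .s X.alg Y.alg, g = g₀.incl (s_le k)
      id_mem := fun X => ⟨AlgHom.id .s X.alg, (AlgHom.incl_id _ _).symm⟩
      comp_mem := by
        rintro X Y Z _ _ ⟨g, rfl⟩ ⟨h, rfl⟩
        exact ⟨g.comp h, (AlgHom.incl_comp _ _ _).symm⟩ }

/-- The forgetful `F`-functor `U`. -/
def forgetF (M : TwoMonad B) (k : Weakness) : FFunctor (M.algF k) (FCat.of B) where
  toStrictPseudofunctor := M.forget k
  map_tight _ _ := trivial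

/-- The inclusion `j` of the 2-category of algebras and strict morphisms. -/
def inclS (M : TwoMonad B) (k : Weakness) : FFunctor (FCat.of (M.Alg .s)) (M.algF k) where
  toStrictPseudofunctor := M.inclusion (s_le k)
  map_tight g _ := ⟨g, rfl⟩

/-- The inclusion `j` between `F`-categories of algebras. -/
def inclF (M : TwoMonad B) {k₁ k₂ : Weakness} (hk : Le k₁ k₂) :
    FFunctor (M.algF k₁) (M.algF k₂) where
  toStrictPseudofunctor := M.inclusion hk
  map_tight := by
    rintro X Y _ ⟨g, rfl⟩
    exact ⟨g, AlgHom.incl_incl_s hk g⟩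

end TwoMonad

end AlgebraFCat

/-- An `F₂`-category: a 2-category (whose 1-cells are called very loose) with wide subcategories
of loose and of tight 1-cells, each tight 1-cell being loose. -/
structure F2Cat where
  carrier : Type u
  [bicategory : Bicategory.{w, v} carrier]
  [strict : Strict carrier]
  loose : WideSubcat carrier
  tight : WideSubcat carrier
  loose_of_tight : ∀ ⦃a b : carrier⦄ (f : a ⟶ b), tight.mem f → loose.mem f

attribute [instance] F2Cat.bicategory F2Cat.strict

namespace F2Cat

variable (𝔸 : F2Cat.{w, v, u})

/-- The 2-category `A_τ` of tight 1-cells. -/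
abbrev Aτ : Type u := 𝔸.tight.Sub

/-- The `F`-category `A_{τ,λ}` of tight and loose 1-cells. -/
abbrev tightLoose : FCat.{w, v, u} where
  carrier := 𝔸.loose.Sub
  tight :=
    { mem := fun _ _ f => 𝔸.tight.mem (WideSubcat.Sub.Hom.hom f)
      id_mem := fun _ => 𝔸.tight.id_mem _
      comp_mem := fun _ _ _ _ _ hf hg => 𝔸.tight.comp_mem _ _ hf hg }

/-- The `F`-category `A_{τ,φ}` of tight and very loose 1-cells. -/
abbrev tightVeryLoose : FCat.{w, v, u} where
  carrier := 𝔸.carrier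
  tight := 𝔸.tight

/-- The inclusion `j : A_{τ,λ} → A_{τ,φ}`. -/
def j : FFunctor 𝔸.tightLoose 𝔸.tightVeryLoose where
  toStrictPseudofunctor := WideSubcat.Sub.forget 𝔸.loose
  map_tight _ hf := hf

/-- The inclusion `j : A_τ → A_{τ,λ}`. -/
def incLoose : FFunctor (FCat.of 𝔸.Aτ) 𝔸.tightLoose where
  toStrictPseudofunctor := WideSubcat.Sub.incl 𝔸.loose_of_tight
  map_tight f _ := WideSubcat.Sub.Hom.mem f

/-- The inclusion `j : A_τ → A_{τ,φ}`. -/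
def incVeryLoose : FFunctor (FCat.of 𝔸.Aτ) 𝔸.tightVeryLoose where
  toStrictPseudofunctor := WideSubcat.Sub.forget 𝔸.tight
  map_tight f _ := WideSubcat.Sub.Hom.mem f

end F2Cat

/-- Given an `F`-functor `H : 𝔸 → B` to a 2-category, a 2-functor `E : A → M-Alg_s` and
`i : A → 𝔸`, the `F`-functor `K : 𝔸 → M-𝔸lg_k` extends `E` along `i` and lives over `B`. -/
structure IsExtensionOver {A : Type u₁} [Bicategory.{w₁, v₁} A] [Strict A] {𝔸 : FCat.{w, v, u}}
    {B : Type u₂} [Bicategory.{w₂, v₂} B] [Strict B] {M : TwoMonad B} {k : Weakness}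
    (i : FFunctor (FCat.of A) 𝔸) (E : StrictPseudofunctor A (M.Alg .s))
    (H : FFunctor 𝔸 (FCat.of B)) (K : FFunctor 𝔸 (M.algF k)) : Prop where
  extends_E : i.comp K = (FFunctor.of E).comp (M.inclS k)
  over_B : K.comp (M.forgetF k) = H

/-! Composites are written in diagrammatic order. Let `f : a ⇝ b` have limit `(p, λ, q)` with vertex
`x`. The cone `(1, f, id)` factors through it by a section `r`, so that `rp = 1`, `rq = f` and `λ`
restricted along `r` is an identity. Every loose 1-cell is thus a section followed by a tight
projection, and `λ` links it to data on which the adjunction is defined.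

The counit `ε` is natural only at tight 1-cells, but `P = FH` acts on all very loose 1-cells, with
tight values. Restricting `λ` along `Pr ε_x : Pa → x` gives a `k`-cell from `Pr ε_x q = Pf ε_b` to
`Pr ε_x p f = ε_a f`, because `p` and `q` are tight. This is `bar f`. Since `HP = TH` and `Hε` is
the algebra structure, `H(bar f)` is a structure cell on `Hf`. By `exists_bar` it can be computed
from any cone with tight legs and a section along which the cone is an identity. The two-dimensional
universal property gives `bar_nat`, naturality of `bar` in all 2-cells. Compatibility with
composition is `bar_nat` at `λ` whiskered by the second 1-cell, and the multiplication axiom is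
`bar_nat` at `bar f` itself.

For a loose `f`, the pseudolimit in `A_{τ,λ}` is one of the admissible cones, although it need not
be a limit in `A_{τ,φ}`. Its cell is invertible, hence so is `bar f`. The pseudo and the
`w`-structure on `Hf` are therefore the same cell, which gives `j E_p = E_w j`.

Uniqueness comes from the same formula. If `K` lifts `H`, then `Kλ` is an algebra 2-cell and `Kp`,
`Kq` are strict; restricting its compatibility condition along `T(Hr)` expresses the structure cell
of `Kf` through `H` and the algebras alone (`cell_same_of_section`).

Associativity and functoriality change the endpoints of cells by equalities, so equations are stated
with `≋` and identity cells with `IsOfEq`; explicit transports then rarely need to be tracked. -/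

namespace Weakness.Cell

/-! ### Cells up to equality of endpoints -/

section
variable {K : Type u} [Category.{v} K] {L : Type u₁} [Category.{v₁} L] {k : Weakness}

/-- Equality of `k`-cells up to equalities of their endpoints. -/
def Same {x y x' y' : K} (φ : Cell k x y) (ψ : Cell k x' y') : Prop :=
  x = x' ∧ y = y' ∧ HEq φ ψ

infix:50 " ≋ " => Weakness.Cell.Same

/-- The `k`-cell is given by an identity. -/
def IsOfEq {x y : K} (φ : Cell k x y) : Prop := ∃ h : x = y, φ = ofEq h k

namespace Same

variable {x y z x' y' z' x'' y'' : K}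

theorem refl (φ : Cell k x y) : φ ≋ φ := ⟨rfl, rfl, HEq.rfl⟩

theorem of_eq {φ ψ : Cell k x y} (h : φ = ψ) : φ ≋ ψ := ⟨rfl, rfl, heq_of_eq h⟩

theorem symm {φ : Cell k x y} {ψ : Cell k x' y'} (h : φ ≋ ψ) : ψ ≋ φ :=
  ⟨h.1.symm, h.2.1.symm, h.2.2.symm⟩

theorem trans {φ : Cell k x y} {ψ : Cell k x' y'} {χ : Cell k x'' y''} (h : φ ≋ ψ)
    (h' : ψ ≋ χ) : φ ≋ χ :=
  ⟨h.1.trans h'.1, h.2.1.trans h'.2.1, h.2.2.trans h'.2.2⟩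

theorem eq {φ ψ : Cell k x y} (h : φ ≋ ψ) : φ = ψ := eq_of_heq h.2.2

theorem comp {φ : Cell k x y} {ψ : Cell k y z} {φ' : Cell k x' y'} {ψ' : Cell k y' z'}
    (h : φ ≋ φ') (h' : ψ ≋ ψ') : φ.comp ψ ≋ φ'.comp ψ' := by
  obtain ⟨rfl, rfl, h⟩ := h
  obtain ⟨-, rfl, h'⟩ := h'
  obtain rfl := eq_of_heq h
  obtain rfl := eq_of_heq h'
  exact refl _

theorem map (F : K ⥤ L) {φ : Cell k x y} {ψ : Cell k x' y'} (h : φ ≋ ψ) :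
    φ.map F ≋ ψ.map F := by
  obtain ⟨rfl, rfl, h⟩ := h
  obtain rfl := eq_of_heq h
  exact refl _

theorem isOfEq {φ : Cell k x y} {ψ : Cell k x' y'} (h : φ ≋ ψ) (hφ : IsOfEq φ) :
    IsOfEq ψ := by
  obtain ⟨rfl, rfl, h⟩ := h
  obtain rfl := eq_of_heq h
  exact hφ

end Same

variable {x y z t x' y' : K}

theorem isOfEq_ofEq (h : x = y) : IsOfEq (ofEq h k) := ⟨h, rfl⟩

theorem IsOfEq.map {φ : Cell k x y} (h : IsOfEq φ) (F : K ⥤ L) : IsOfEq (φ.map F) := by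
  obtain ⟨h, rfl⟩ := h
  exact ⟨_, map_ofEq F h⟩

theorem IsOfEq.same {φ : Cell k x y} {ψ : Cell k x' y'} (h : IsOfEq φ) (h' : IsOfEq ψ)
    (e : x = x') : φ ≋ ψ := by
  obtain ⟨rfl, rfl⟩ := h
  obtain ⟨rfl, rfl⟩ := h'
  subst e
  exact Same.refl _

theorem IsOfEq.comp_left {φ : Cell k x y} (h : IsOfEq φ) (ψ : Cell k y z) :
    φ.comp ψ ≋ ψ := by
  obtain ⟨rfl, rfl⟩ := h
  exact Same.of_eq (ofEq_comp _ _)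

theorem IsOfEq.comp_right (φ : Cell k x y) {ψ : Cell k y z} (h : IsOfEq ψ) :
    φ.comp ψ ≋ φ := by
  obtain ⟨rfl, rfl⟩ := h
  exact Same.of_eq (comp_ofEq _ _)

/-- Transport of a `k`-cell along equalities of its endpoints. -/
def cast (φ : Cell k x y) (hx : x' = x) (hy : y = y') : Cell k x' y' :=
  (ofEq hx k).comp (φ.comp (ofEq hy k))

theorem cast_same (φ : Cell k x y) (hx : x' = x) (hy : y = y') : φ.cast hx hy ≋ φ :=
  (IsOfEq.comp_left (isOfEq_ofEq _) _).trans (IsOfEq.comp_right _ (isOfEq_ofEq _))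

/-- An isomorphism is determined by its forward map and also by its inverse. Equations between
invertible cells may therefore be checked among lax or colax ones. -/
theorem incl_injective {k' : Weakness} (hk : Le k k') (hs : k ≠ .s) {φ ψ : Cell k x y}
    (h : φ.incl hk = ψ.incl hk) : φ = ψ := by
  cases k
  · exact (hs rfl).elim
  · cases k'
    · exact hk.elim
    · exact h
    · exact Iso.ext h
    · exact Iso.ext_inv h
  all_goals cases k' <;> first | exact h | exact hk.elim

theorem Same.of_incl {k' : Weakness} (hk : Le k k') (hs : k ≠ .s) {φ : Cell k x y}
    {ψ : Cell k x' y'} (h : φ.incl hk ≋ ψ.incl hk) : φ ≋ ψ := by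
  obtain ⟨rfl, rfl, h⟩ := h
  exact Same.of_eq (incl_injective hk hs (eq_of_heq h))

theorem IsOfEq.incl {k' : Weakness} (hk : Le k k') {φ : Cell k x y} (h : IsOfEq φ) :
    IsOfEq (φ.incl hk) := by
  obtain ⟨h, rfl⟩ := h
  exact ⟨h, incl_ofEq hk h⟩

theorem IsOfEq.of_incl {k' : Weakness} (hk : Le k k') (hs : k ≠ .s) {φ : Cell k x y}
    (h : IsOfEq (φ.incl hk)) : IsOfEq φ := by
  obtain ⟨h, e⟩ := h
  exact ⟨h, incl_injective hk hs (e.trans (incl_ofEq hk h).symm)⟩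

theorem incl_cast {k' : Weakness} (hk : Le k k') (φ : Cell k x y) (hx : x' = x) (hy : y = y') :
    (φ.cast hx hy).incl hk = (φ.incl hk).cast hx hy := by
  simp only [cast, incl_comp, incl_ofEq]

/-- Only the colax case has content: there the inclusion takes inverses, which have to be moved
across the square. -/
theorem square_of_incl {φ : Cell .p x y} {ψ : Cell .p x' y'} {α : x ⟶ x'} {β : y ⟶ y'}
    (hk : Le .p k) (h : Square (φ.incl hk) (ψ.incl hk) α β) : Square φ ψ α β := by
  cases k
  · exact hk.elim
  · exact h
  · exact h
  · change x ≅ y at φ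
    change x' ≅ y' at ψ
    change φ.inv ≫ α = β ≫ ψ.inv at h
    change α ≫ ψ.hom = φ.hom ≫ β
    rw [← Iso.inv_comp_eq, ← Category.assoc, h, Category.assoc, Iso.inv_hom_id,
      Category.comp_id]

end

/-! ### Whiskering and 2-functors up to equality of endpoints -/

section
variable {B : Type u} [Bicategory.{w, v} B] {C : Type u₁} [Bicategory.{w₁, v₁} C]
  {a b c d : B} {k : Weakness}

theorem mapCell_mapCell {D : Type u₂} [Bicategory.{w₂, v₂} D] (S : StrictPseudofunctor B C)
    (T : StrictPseudofunctor C D) {x y : a ⟶ b} (φ : Cell k x y) :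
    (φ.mapCell S).mapCell T = φ.mapCell (S.comp T) := by
  cases k <;> rfl

theorem Same.whiskerLeft {x y x' y' : b ⟶ c} {φ : Cell k x y} {ψ : Cell k x' y'} (h : φ ≋ ψ)
    {f g : a ⟶ b} (e : f = g) : φ.whiskerLeft f ≋ ψ.whiskerLeft g := by
  subst e
  exact h.map _

theorem Same.whiskerRight {x y x' y' : a ⟶ b} {φ : Cell k x y} {ψ : Cell k x' y'} (h : φ ≋ ψ)
    {f g : b ⟶ c} (e : f = g) : φ.whiskerRight f ≋ ψ.whiskerRight g := by
  subst e
  exact h.map _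

theorem Same.mapCell (T : StrictPseudofunctor B C) {x y x' y' : a ⟶ b} {φ : Cell k x y}
    {ψ : Cell k x' y'} (h : φ ≋ ψ) : φ.mapCell T ≋ ψ.mapCell T := h.map _

theorem IsOfEq.whiskerLeft {x y : b ⟶ c} {φ : Cell k x y} (h : IsOfEq φ) (f : a ⟶ b) :
    IsOfEq (φ.whiskerLeft f) := h.map _

theorem IsOfEq.whiskerRight {x y : a ⟶ b} {φ : Cell k x y} (h : IsOfEq φ) (f : b ⟶ c) :
    IsOfEq (φ.whiskerRight f) := h.map _

theorem IsOfEq.mapCell {x y : a ⟶ b} {φ : Cell k x y} (h : IsOfEq φ)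
    (T : StrictPseudofunctor B C) : IsOfEq (φ.mapCell T) := h.map _

theorem mapCell_whiskerLeft_same (T : StrictPseudofunctor B C) (f : a ⟶ b) {x y : b ⟶ c}
    (φ : Cell k x y) : (φ.whiskerLeft f).mapCell T ≋ (φ.mapCell T).whiskerLeft (T.map f) := by
  refine (Same.of_eq ((map_map _ _ φ).trans (map_congr (map_precomp_eq T f c) φ))).trans ?_
  rw [← map_map]
  exact cast_same _ _ _

theorem mapCell_whiskerRight_same (T : StrictPseudofunctor B C) {x y : a ⟶ b} (φ : Cell k x y)
    (f : b ⟶ c) : (φ.whiskerRight f).mapCell T ≋ (φ.mapCell T).whiskerRight (T.map f) := by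
  refine (Same.of_eq ((map_map _ _ φ).trans (map_congr (map_postcomp_eq T a f) φ))).trans ?_
  rw [← map_map]
  exact cast_same _ _ _

variable [Strict B]

theorem whiskerLeft_comp_same (f : a ⟶ b) (g : b ⟶ c) {x y : c ⟶ d} (φ : Cell k x y) :
    φ.whiskerLeft (f ≫ g) ≋ (φ.whiskerLeft g).whiskerLeft f :=
  (Same.of_eq (whiskerLeft_comp f g φ)).trans (cast_same _ _ _)

theorem whiskerRight_comp_same {x y : a ⟶ b} (φ : Cell k x y) (f : b ⟶ c) (g : c ⟶ d) :
    φ.whiskerRight (f ≫ g) ≋ (φ.whiskerRight f).whiskerRight g :=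
  (Same.of_eq (whiskerRight_comp φ f g)).trans (cast_same _ _ _)

theorem whiskerLeft_whiskerRight_same (f : a ⟶ b) {x y : b ⟶ c} (φ : Cell k x y) (g : c ⟶ d) :
    (φ.whiskerRight g).whiskerLeft f ≋ (φ.whiskerLeft f).whiskerRight g :=
  (Same.of_eq (whiskerLeft_whiskerRight f φ g)).trans (cast_same _ _ _)

theorem id_whiskerLeft_same {x y : a ⟶ b} (φ : Cell k x y) : φ.whiskerLeft (𝟙 a) ≋ φ :=
  (Same.of_eq (id_whiskerLeft φ)).trans (cast_same _ _ _)

theorem whiskerLeft_same_of_eq_id {x y : a ⟶ b} (φ : Cell k x y) {f : a ⟶ a} (h : f = 𝟙 a) :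
    φ.whiskerLeft f ≋ φ :=
  ((Same.refl φ).whiskerLeft h).trans (id_whiskerLeft_same φ)

end

end Weakness.Cell

open Weakness.Cell

/-! ### Limits of loose 1-cells: lifting and sections -/

namespace FCat

variable {𝔸 : FCat.{w, v, u}} {k : Weakness}

namespace BarCone

variable {a b : 𝔸.carrier} {f : a ⟶ b} {x y : 𝔸.carrier}

theorem ext_same {C D : BarCone k f x} (hr : C.r = D.r) (hs : C.s = D.s) (h : C.α ≋ D.α) :
    C = D := by
  obtain ⟨r, s, α⟩ := C
  obtain ⟨r', s', β⟩ := D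
  obtain rfl : r = r' := hr
  obtain rfl : s = s' := hs
  obtain rfl : α = β := h.eq
  rfl

theorem same_of_eq {C D : BarCone k f x} (h : C = D) : C.α ≋ D.α := by
  subst h; exact Same.refl _

theorem precomp_same (C : BarCone k f x) (t : y ⟶ x) : (C.precomp t).α ≋ C.α.whiskerLeft t :=
  IsOfEq.comp_right _ (isOfEq_ofEq _)

namespace IsLimit

variable {C : BarCone k f x}

theorem exists_lift (hC : C.IsLimit) (r : y ⟶ a) (s : y ⟶ b) (α : Cell k s (r ≫ f)) :
    ∃ t : y ⟶ x, t ≫ C.r = r ∧ t ≫ C.s = s ∧ C.α.whiskerLeft t ≋ α := by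
  obtain ⟨t, ht, -⟩ := hC.existsUnique_lift y ⟨r, s, α⟩
  exact ⟨t, congrArg BarCone.r ht, congrArg BarCone.s ht,
    (precomp_same C t).symm.trans (same_of_eq ht)⟩

theorem hom_ext (hC : C.IsLimit) {t t' : y ⟶ x} (hr : t ≫ C.r = t' ≫ C.r)
    (hs : t ≫ C.s = t' ≫ C.s) (h : C.α.whiskerLeft t ≋ C.α.whiskerLeft t') : t = t' :=
  (hC.existsUnique_lift y (C.precomp t')).unique
    (ext_same hr hs ((precomp_same C t).trans (h.trans (precomp_same C t').symm))) rfl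

theorem tight_of_comp (hC : C.IsLimit) {t : y ⟶ x} (hr : 𝔸.tight.mem (t ≫ C.r))
    (hs : 𝔸.tight.mem (t ≫ C.s)) : 𝔸.tight.mem t :=
  (hC.tight_iff y t).2 ⟨hr, hs⟩

/-- Lax and colax limits lift `k`-cells. -/
theorem exists_lift_cell (hC : C.IsLimit) (hk : k = .l ∨ k = .c) {t t' : y ⟶ x}
    (θr : Cell k (t ≫ C.r) (t' ≫ C.r)) (θs : Cell k (t ≫ C.s) (t' ≫ C.s))
    (h : (C.precomp t).α.comp (θr.whiskerRight f) = θs.comp (C.precomp t').α) :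
    ∃ φ : Cell k t t', φ.whiskerRight C.r = θr ∧ φ.whiskerRight C.s = θs := by
  rcases hk with rfl | rfl
  · obtain ⟨φ, hφ, -⟩ := hC.existsUnique_lift₂ y t t' θr θs h.symm
    exact ⟨φ, hφ⟩
  -- A `c`-cell from `t` to `t'` is a 2-cell `t' ⟶ t`, hence the exchange.
  · obtain ⟨φ, hφ, -⟩ := hC.existsUnique_lift₂ y t' t θr θs h.symm
    exact ⟨φ, hφ⟩

/-- The section of the first projection determined by the identity cone. -/
theorem exists_section (hC : C.IsLimit) : ∃ r : a ⟶ x, r ≫ C.r = 𝟙 a ∧ r ≫ C.s = f ∧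
    IsOfEq (C.α.whiskerLeft r) := by
  obtain ⟨r, hr, hs, h⟩ := hC.exists_lift (𝟙 a) f (ofEq (Strict.id_comp f).symm k)
  exact ⟨r, hr, hs, h.symm.isOfEq (isOfEq_ofEq _)⟩

end IsLimit

end BarCone

/-! ### The canonical cell measuring non-naturality of the counit -/

/-- A 2-functor on an `F`-category with values in tight 1-cells, with tight 1-cells to the
identity natural with respect to tight 1-cells. -/
structure TightCounit (𝔸 : FCat.{w, v, u}) where
  P : StrictPseudofunctor 𝔸.carrier 𝔸.carrier
  tight_map : ∀ {a b : 𝔸.carrier} (f : a ⟶ b), 𝔸.tight.mem (P.map f)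
  counit : ∀ a : 𝔸.carrier, P.obj a ⟶ a
  tight_counit : ∀ a, 𝔸.tight.mem (counit a)
  nat : ∀ {a b : 𝔸.carrier} (s : a ⟶ b), 𝔸.tight.mem s → P.map s ≫ counit b = counit a ≫ s

namespace TightCounit

variable (Q : TightCounit 𝔸) {a b c : 𝔸.carrier}

/-- The loose `r` stays inside `P`, so naturality is needed only at `s`. This identifies the
endpoints of a limit cone restricted along `P r ≫ counit`. -/
theorem comp_counit_comp {x y z : 𝔸.carrier} (r : x ⟶ y) (s : y ⟶ z) (hs : 𝔸.tight.mem s) :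
    (Q.P.map r ≫ Q.counit y) ≫ s = Q.P.map (r ≫ s) ≫ Q.counit z := by
  rw [Q.P.map_comp, Strict.assoc, Strict.assoc, Q.nat s hs]

/-- A cone with tight legs factors through the limit by a 1-cell `u`, which is tight because the
limit projections detect tightness. Naturality at `u` then compares the two restrictions.
Independence of the limit is built into the statement, and `C` need not be a limit: this freedom is
what later allows pseudolimits. -/
theorem exists_bar (h𝔸 : 𝔸.HasBarLimits k) (f : a ⟶ b) :
    ∃ β : Cell k (Q.P.map f ≫ Q.counit b) (Q.counit a ≫ f),
      ∀ (x y : 𝔸.carrier) (C : BarCone k f x) (r : y ⟶ x), 𝔸.tight.mem C.r → 𝔸.tight.mem C.s →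
        IsOfEq (C.α.whiskerLeft r) →
          C.α.whiskerLeft (Q.P.map r ≫ Q.counit x) ≋ β.whiskerLeft (Q.P.map (r ≫ C.r)) := by
  obtain ⟨l, D, hD⟩ := h𝔸 a b f
  obtain ⟨t, ht₁, ht₂, ht⟩ := hD.exists_section
  have e₁ : (Q.P.map t ≫ Q.counit l) ≫ D.s = Q.P.map f ≫ Q.counit b := by
    rw [Q.comp_counit_comp _ _ hD.tight_s, ht₂]
  have e₂ : (Q.P.map t ≫ Q.counit l) ≫ D.r = Q.counit a := by
    rw [Q.comp_counit_comp _ _ hD.tight_r, ht₁, Q.P.map_id, Strict.id_comp]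
  -- The limit cone restricted along `P t ≫ counit`, where `t` is its section.
  refine ⟨(D.α.whiskerLeft (Q.P.map t ≫ Q.counit l)).cast e₁.symm
    ((Strict.assoc _ _ _).symm.trans (congrArg (· ≫ f) e₂)), fun x y C r hr hs hC => ?_⟩
  obtain ⟨u, hu₁, hu₂, hu⟩ := hD.exists_lift C.r C.s C.α
  have hut : 𝔸.tight.mem u := hD.tight_of_comp (hu₁ ▸ hr) (hu₂ ▸ hs)
  have hC' : r ≫ C.s = (r ≫ C.r) ≫ f := hC.1.trans (Strict.assoc _ _ _).symm
  -- Both sides induce the identity cone with first leg `r ≫ C.r`, so uniqueness of lifts applies.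
  have e : r ≫ u = (r ≫ C.r) ≫ t := by
    refine hD.hom_ext ?_ ?_ ?_
    · rw [Strict.assoc, hu₁, Strict.assoc, Strict.assoc, ht₁, Strict.comp_id]
    · rw [Strict.assoc, hu₂, Strict.assoc, Strict.assoc, ht₂, hC', Strict.assoc]
    · refine IsOfEq.same (((whiskerLeft_comp_same _ _ _).trans
        (hu.whiskerLeft rfl)).symm.isOfEq hC)
        ((whiskerLeft_comp_same _ _ _).symm.isOfEq (ht.whiskerLeft _)) ?_
      rw [Strict.assoc, hu₂, Strict.assoc, Strict.assoc, ht₂, hC', Strict.assoc]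
  refine (hu.symm.whiskerLeft rfl).trans ((whiskerLeft_comp_same _ _ _).symm.trans ?_)
  refine Same.trans ?_ ((cast_same _ _ _).symm.whiskerLeft rfl)
  refine Same.trans ?_ (whiskerLeft_comp_same _ _ _)
  refine (Same.refl _).whiskerLeft ?_
  rw [Q.comp_counit_comp _ _ hut, e, Q.P.map_comp, Strict.assoc]

/-- The canonical `k`-cell measuring the failure of naturality at a loose 1-cell. -/
noncomputable def bar (h𝔸 : 𝔸.HasBarLimits k) (f : a ⟶ b) :
    Cell k (Q.P.map f ≫ Q.counit b) (Q.counit a ≫ f) :=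
  (Q.exists_bar h𝔸 f).choose

variable (h𝔸 : 𝔸.HasBarLimits k)

theorem bar_congr {f g : a ⟶ b} (h : f = g) : Q.bar h𝔸 f ≋ Q.bar h𝔸 g := by
  subst h; exact Same.refl _

theorem cone_same_bar {f : a ⟶ b} {x y : 𝔸.carrier} (C : BarCone k f x) (r : y ⟶ x)
    (hr : 𝔸.tight.mem C.r) (hs : 𝔸.tight.mem C.s) (h : IsOfEq (C.α.whiskerLeft r)) :
    C.α.whiskerLeft (Q.P.map r ≫ Q.counit x) ≋ (Q.bar h𝔸 f).whiskerLeft (Q.P.map (r ≫ C.r)) :=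
  (Q.exists_bar h𝔸 f).choose_spec x y C r hr hs h

theorem cone_same_bar_of_section {f : a ⟶ b} {x : 𝔸.carrier} (C : BarCone k f x) (r : a ⟶ x)
    (hr : 𝔸.tight.mem C.r) (hs : 𝔸.tight.mem C.s) (h : IsOfEq (C.α.whiskerLeft r))
    (h₁ : r ≫ C.r = 𝟙 a) :
    C.α.whiskerLeft (Q.P.map r ≫ Q.counit x) ≋ Q.bar h𝔸 f :=
  (Q.cone_same_bar h𝔸 C r hr hs h).trans
    (whiskerLeft_same_of_eq_id _ (by rw [h₁, Q.P.map_id]))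

/-- For tight `f` the identity cone `(𝟙, f, id)` itself has tight legs, and `𝟙` is a section of it;
the cell it yields is an identity. -/
theorem bar_tight {f : a ⟶ b} (hf : 𝔸.tight.mem f) : IsOfEq (Q.bar h𝔸 f) :=
  (Q.cone_same_bar_of_section h𝔸 ⟨𝟙 a, f, ofEq (Strict.id_comp f).symm k⟩ (𝟙 a)
    (𝔸.tight.id_mem a) hf ((isOfEq_ofEq _).whiskerLeft _) (Strict.id_comp _)).isOfEq
    ((isOfEq_ofEq _).whiskerLeft _)

/-- Composing the first leg of a limit cone on `s ≫ f` with the tight `s` turns it into a cone on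
`f` with tight legs. Both canonical cells are then read off from this one cone. -/
theorem bar_precomp {s : a ⟶ b} (hs : 𝔸.tight.mem s) (f : b ⟶ c) :
    Q.bar h𝔸 (s ≫ f) ≋ (Q.bar h𝔸 f).whiskerLeft (Q.P.map s) := by
  obtain ⟨l, D, hD⟩ := h𝔸 a c (s ≫ f)
  obtain ⟨t, ht₁, ht₂, ht⟩ := hD.exists_section
  let C : BarCone k f l := ⟨D.r ≫ s, D.s, D.α.cast rfl (Strict.assoc _ _ _).symm⟩
  have hC : C.α ≋ D.α := cast_same _ _ _
  refine (Q.cone_same_bar_of_section h𝔸 D t hD.tight_r hD.tight_s ht ht₁).symm.trans ?_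
  refine (hC.symm.whiskerLeft rfl).trans ?_
  refine (Q.cone_same_bar h𝔸 C t (𝔸.tight.comp_mem _ _ hD.tight_r hs) hD.tight_s
    ((hC.symm.whiskerLeft rfl).isOfEq ht)).trans ((Same.refl _).whiskerLeft ?_)
  change Q.P.map (t ≫ D.r ≫ s) = _
  rw [← Strict.assoc, ht₁, Strict.id_comp]

theorem whiskerRight_counit_whiskerRight {x y : a ⟶ b} (ψ : Cell k x y) (s : b ⟶ c)
    (hs : 𝔸.tight.mem s) : ((ψ.mapCell Q.P).whiskerRight (Q.counit b)).whiskerRight s ≋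
      ((ψ.whiskerRight s).mapCell Q.P).whiskerRight (Q.counit c) :=
  (whiskerRight_comp_same _ _ _).symm.trans (((Same.refl _).whiskerRight (Q.nat s hs).symm).trans
    ((whiskerRight_comp_same _ _ _).trans
      ((mapCell_whiskerRight_same Q.P ψ s).symm.whiskerRight rfl)))

/-- The cell `α` is realised as a cell `ψ` between two 1-cells into the limit of `g`, one induced by
the section for `f`, the other the section for `g`. The claim is then interchange of `P ψ ▷ counit`
with the limit cell. -/
theorem bar_nat (hk : k = .l ∨ k = .c) {f g : a ⟶ b} (α : Cell k f g) :
    (Q.bar h𝔸 f).comp (α.whiskerLeft (Q.counit a)) =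
      ((α.mapCell Q.P).whiskerRight (Q.counit b)).comp (Q.bar h𝔸 g) := by
  obtain ⟨l, C, hC⟩ := h𝔸 a b f
  obtain ⟨m, D, hD⟩ := h𝔸 a b g
  obtain ⟨r, hr₁, hr₂, hr⟩ := hC.exists_section
  obtain ⟨t, ht₁, ht₂, ht⟩ := hD.exists_section
  -- Pasting `α` onto the limit cone of `f` gives a cone on `g`; `u` is the induced tight comparison
  -- of limits.
  obtain ⟨u, hu₁, hu₂, hu⟩ := hD.exists_lift C.r C.s (C.α.comp (α.whiskerLeft C.r))
  have hut : 𝔸.tight.mem u := hD.tight_of_comp (hu₁ ▸ hC.tight_r) (hu₂ ▸ hC.tight_s)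
  have er : (r ≫ u) ≫ D.r = t ≫ D.r := by rw [Strict.assoc, hu₁, hr₁, ht₁]
  have es : (r ≫ u) ≫ D.s = f := by rw [Strict.assoc, hu₂, hr₂]
  -- Restricting that cone along `r` leaves just `α`, while restricting `D` along `t` leaves an
  -- identity. So the pair (identity, `α`) is compatible and lifts.
  obtain ⟨ψ, hψr, hψs⟩ := hD.exists_lift_cell hk (t := r ≫ u) (t' := t) (ofEq er k)
    (α.cast es ht₂.symm) (by
      refine Same.eq ?_
      have h₁ : (D.precomp (r ≫ u)).α ≋ α := by
        refine (BarCone.precomp_same _ _).trans ((whiskerLeft_comp_same _ _ _).trans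
          ((hu.whiskerLeft rfl).trans ?_))
        rw [whiskerLeft_vcomp]
        exact (hr.comp_left _).trans ((whiskerLeft_comp_same _ _ _).symm.trans
          (whiskerLeft_same_of_eq_id _ hr₁))
      refine (IsOfEq.comp_right _ ((isOfEq_ofEq _).whiskerRight _)).trans (h₁.trans ?_)
      exact ((IsOfEq.comp_right _ ((BarCone.precomp_same _ _).symm.isOfEq ht)).trans
        (cast_same _ _ _)).symm)
  have hx := Cell.whisker_exchange ((ψ.mapCell Q.P).whiskerRight (Q.counit m)) D.α
  refine Same.eq (Same.trans (Same.trans ?_ (Same.of_eq hx)) ?_)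
  -- On this side `ψ` enters only through its first projection, which is an identity; the factor
  -- drops out.
  · refine Same.symm ((IsOfEq.comp_right _ ?_).trans ?_)
    · refine (whiskerRight_comp_same _ _ _).symm.isOfEq (IsOfEq.whiskerRight ?_ _)
      refine (Q.whiskerRight_counit_whiskerRight _ _ hD.tight_r).symm.isOfEq ?_
      rw [hψr]
      exact ((isOfEq_ofEq _).mapCell _).whiskerRight _
    · refine ((Same.refl _).whiskerLeft (Q.comp_counit_comp r u hut).symm).trans
        ((whiskerLeft_comp_same _ _ _).trans ((hu.whiskerLeft rfl).trans ?_))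
      rw [whiskerLeft_vcomp]
      refine Same.comp (Q.cone_same_bar_of_section h𝔸 C r hC.tight_r hC.tight_s hr hr₁)
        ((whiskerLeft_comp_same _ _ _).symm.trans ((Same.refl _).whiskerLeft ?_))
      rw [Q.comp_counit_comp _ _ hC.tight_r, hr₁, Q.P.map_id, Strict.id_comp]
  · refine Same.comp ?_ (Q.cone_same_bar_of_section h𝔸 D t hD.tight_r hD.tight_s ht ht₁)
    refine (Q.whiskerRight_counit_whiskerRight _ _ hD.tight_s).trans ?_
    rw [hψs]
    exact ((cast_same _ _ _).mapCell _).whiskerRight rfl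

/-- This is naturality at `C.α ▷ g`, a cell from `C.s ≫ g` to `C.r ≫ f ≫ g`, restricted along `P r`.
The legs are tight, so `bar_precomp` strips them off, and the factor containing `P C.α` becomes an
identity because `C.α` is one along `r`. -/
theorem bar_comp (hk : k = .l ∨ k = .c) (f : a ⟶ b) (g : b ⟶ c) :
    Q.bar h𝔸 (f ≫ g) ≋ ((Q.bar h𝔸 g).whiskerLeft (Q.P.map f)).comp
      (((Q.bar h𝔸 f).whiskerRight g).cast (Strict.assoc _ _ _).symm (Strict.assoc _ _ _)) := by
  obtain ⟨l, C, hC⟩ := h𝔸 a b f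
  obtain ⟨r, hr₁, hr₂, hr⟩ := hC.exists_section
  have h := congrArg (Cell.whiskerLeft (Q.P.map r)) (Q.bar_nat h𝔸 hk (C.α.whiskerRight g))
  rw [whiskerLeft_vcomp, whiskerLeft_vcomp] at h
  refine Same.trans (Same.symm ?_) ((Same.of_eq h).symm.trans (Same.comp ?_ ?_))
  · refine (IsOfEq.comp_left ?_ _).trans ?_
    · refine (whiskerLeft_whiskerRight_same _ _ _).symm.isOfEq (IsOfEq.whiskerRight ?_ _)
      refine (mapCell_whiskerLeft_same _ _ _).isOfEq (IsOfEq.mapCell ?_ _)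
      exact (whiskerLeft_whiskerRight_same _ _ _).symm.isOfEq (hr.whiskerRight _)
    · refine (((Q.bar_congr h𝔸 (Strict.assoc _ _ _)).trans
        (Q.bar_precomp h𝔸 hC.tight_r _)).whiskerLeft rfl).trans ?_
      refine (whiskerLeft_comp_same _ _ _).symm.trans (whiskerLeft_same_of_eq_id _ ?_)
      rw [← Q.P.map_comp, hr₁, Q.P.map_id]
  · refine ((Q.bar_precomp h𝔸 hC.tight_s _).whiskerLeft rfl).trans ?_
    refine (whiskerLeft_comp_same _ _ _).symm.trans ((Same.refl _).whiskerLeft ?_)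
    rw [← Q.P.map_comp, hr₂]
  · refine Same.trans ?_ (cast_same _ _ _).symm
    refine (whiskerLeft_comp_same _ _ _).symm.trans ((whiskerLeft_whiskerRight_same _ _ _).trans ?_)
    exact (Q.cone_same_bar_of_section h𝔸 C r hC.tight_r hC.tight_s hr hr₁).whiskerRight rfl

end TightCounit

end FCat

/-! ### Equality of `F`-functors -/

namespace FFunctor

variable {𝔸 : FCat.{w, v, u}} {𝔹 : FCat.{w₁, v₁, u₁}}

/-- The coherence isomorphisms of a 2-functor are prescribed identities, so they carry no further
data. -/
theorem ext_heq {K K' : FFunctor 𝔸 𝔹} (hobj : ∀ a, K.obj a = K'.obj a)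
    (hmap : ∀ {a b : 𝔸.carrier} (f : a ⟶ b), HEq (K.map f) (K'.map f))
    (hmap₂ : ∀ {a b : 𝔸.carrier} {f g : a ⟶ b} (α : f ⟶ g), HEq (K.map₂ α) (K'.map₂ α)) :
    K = K' := by
  obtain ⟨⟨⟨⟨⟨⟨⟨obj, map⟩, map₂⟩, _, _⟩, mapId, mapComp, _, _, _, _, _⟩, _, hI⟩, _, hC⟩, _⟩ := K
  obtain ⟨⟨⟨⟨⟨⟨⟨obj', map'⟩, map₂'⟩, _, _⟩, mapId', mapComp', _, _, _, _, _⟩, _, hI'⟩, _, hC'⟩,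
    _⟩ := K'
  obtain rfl : obj = obj' := funext hobj
  obtain rfl : @map = @map' := by
    funext a b f
    exact eq_of_heq (hmap f)
  obtain rfl : @map₂ = @map₂' := by
    funext a b f g α
    exact eq_of_heq (hmap₂ α)
  obtain rfl : mapId = mapId' := funext fun a => (hI a).trans (hI' a).symm
  obtain rfl : @mapComp = @mapComp' := by
    funext a b c f g
    exact (hC f g).trans (hC' f g).symm
  rfl

theorem map_heq {K K' : FFunctor 𝔸 𝔹} (h : K = K') {a b : 𝔸.carrier} (f : a ⟶ b) :
    HEq (K.map f) (K'.map f) := by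
  subst h; rfl

theorem map₂_heq {K K' : FFunctor 𝔸 𝔹} (h : K = K') {a b : 𝔸.carrier} {f g : a ⟶ b}
    (α : f ⟶ g) : HEq (K.map₂ α) (K'.map₂ α) := by
  subst h; rfl

theorem mapCell_heq {K K' : FFunctor 𝔸 𝔹} (h : K = K') {k : Weakness} {a b : 𝔸.carrier}
    {f g : a ⟶ b} (φ : Cell k f g) :
    HEq (φ.mapCell K.toStrictPseudofunctor) (φ.mapCell K'.toStrictPseudofunctor) := by
  subst h; rfl

end FFunctor

/-! ### Uniqueness of lifts to algebras -/

namespace TwoMonad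

variable {B : Type u₁} [Bicategory.{w₁, v₁} B] [Strict B] {M : TwoMonad B} {k : Weakness}

theorem AlgHom.cell_same_of_eq {X Y : M.Algebra} {g h : AlgHom k X Y} (e : g = h) :
    g.cell ≋ h.cell := by
  subst e; exact Same.refl _

theorem AlgHom.hom₂_heq {X Y X' Y' : M.Alg k} {g h : X ⟶ Y} {g' h' : X' ⟶ Y'} (eX : X = X')
    (eY : Y = Y') (e : HEq g g') (e' : HEq h h') {α : g ⟶ h} {β : g' ⟶ h'}
    (H : HEq (AlgHom.Hom₂.hom α) (AlgHom.Hom₂.hom β)) : HEq α β := by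
  subst eX eY
  obtain rfl := eq_of_heq e
  obtain rfl := eq_of_heq e'
  exact heq_of_eq (Alg.hom₂_ext (eq_of_heq H))

/-- Two lifts agree on objects only propositionally. All ingredients of the formula for the
structure cell are therefore compared heterogeneously and substituted at once. -/
theorem AlgHom.heq_of_cell_same {k' : Weakness} (hs : k ≠ .s) (hk : Le k k')
    {X X' Y Y' Z Z' : M.Algebra} (eX : X = X') (eY : Y = Y') (eZ : Z = Z') {g : AlgHom k X Y}
    {g' : AlgHom k X' Y'} (hg : HEq g.f g'.f) {r : X.obj ⟶ Z.obj} {r' : X'.obj ⟶ Z'.obj}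
    (hr : HEq r r') {s t : Z.obj ⟶ Y.obj} {s' t' : Z'.obj ⟶ Y'.obj} (hs' : HEq s s')
    (ht : HEq t t') {φ : Cell k' s t} {φ' : Cell k' s' t'} (hφ : HEq φ φ')
    (h : g.cell.incl hk ≋ φ.whiskerLeft (M.T.map r ≫ Z.str))
    (h' : g'.cell.incl hk ≋ φ'.whiskerLeft (M.T.map r' ≫ Z'.str)) : HEq g g' := by
  subst eX eY eZ
  obtain rfl := eq_of_heq hr
  obtain rfl := eq_of_heq hs'
  obtain rfl := eq_of_heq ht
  obtain rfl := eq_of_heq hφ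
  exact heq_of_eq (AlgHom.ext_cell (eq_of_heq hg) ((h.trans h'.symm).of_incl hk hs).2.2)

theorem AlgHom.comp_cell_same {X Y Z : M.Algebra} (g : AlgHom k X Y) (h : AlgHom k Y Z) :
    (g.comp h).cell ≋ (h.cell.whiskerLeft (M.T.map g.f)).comp
      ((g.cell.whiskerRight h.f).cast (Strict.assoc _ _ _).symm (Strict.assoc _ _ _)) :=
  (isOfEq_ofEq _).comp_left _

theorem AlgHom.comp_cell_same_of_isOfEq {X Y Z : M.Algebra} (g : AlgHom k X Y)
    (h : AlgHom k Y Z) (hg : IsOfEq g.cell) :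
    (g.comp h).cell ≋ h.cell.whiskerLeft (M.T.map g.f) :=
  (AlgHom.comp_cell_same g h).trans
    (IsOfEq.comp_right _ ((cast_same _ _ _).symm.isOfEq (hg.whiskerRight _)))

/-- A `k`-cell between `k`-morphisms of algebras is compatible with their structure cells. -/
theorem AlgHom.cell_nat (hk : k = .l ∨ k = .c) {X Y : M.Alg k} {g h : X ⟶ Y} (γ : Cell k g h) :
    (AlgHom.cell g).comp ((γ.mapCell (M.forget k)).whiskerLeft X.alg.str) =
      (((γ.mapCell (M.forget k)).mapCell M.T).whiskerRight Y.alg.str).comp (AlgHom.cell h) := by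
  rcases hk with rfl | rfl
  · exact (AlgHom.Hom₂.square (M := M) (k := .l) γ).symm
  · exact (AlgHom.Hom₂.square (M := M) (k := .c) γ).symm

theorem isOfEq_cell_of_tight {X Y : M.Alg k} {g : X ⟶ Y} (h : (M.algF k).tight.mem g) :
    IsOfEq (AlgHom.cell g) := by
  obtain ⟨g₀, rfl⟩ := h
  exact ⟨g₀.cell.down.down, rfl⟩

section
variable {A : Type u} [Bicategory.{w, v} A] [Strict A]

/-- The structure cell of the image of `f` is determined by a `k`-cell to `p ≫ f` that
becomes an identity on a section of `p`. -/
theorem cell_same_of_section (hk : k = .l ∨ k = .c) (K : StrictPseudofunctor A (M.Alg k))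
    {a b x : A} {f : a ⟶ b} {p : x ⟶ a} {q : x ⟶ b} (lam : Cell k q (p ≫ f)) (r : a ⟶ x)
    (hr : r ≫ p = 𝟙 a) (hlam : IsOfEq (lam.whiskerLeft r))
    (hp : IsOfEq (AlgHom.cell (K.map p))) (hq : IsOfEq (AlgHom.cell (K.map q))) :
    AlgHom.cell (K.map f) ≋ (lam.mapCell (K.comp (M.forget k))).whiskerLeft
      (M.T.map (AlgHom.f (K.map r)) ≫ (K.obj x).alg.str) := by
  -- Compatibility of the algebra cell `K lam` with the structure cells of `K q` and `K (p ≫ f)`,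
  -- restricted along `T (K r)`.
  have h := congrArg (Cell.whiskerLeft (M.T.map (AlgHom.f (K.map r))))
    (AlgHom.cell_nat hk (lam.mapCell K))
  rw [mapCell_mapCell] at h
  replace h := (whiskerLeft_vcomp _ _ _).symm.trans (h.trans (whiskerLeft_vcomp _ _ _))
  refine Same.symm (Same.trans ?_ ((Same.of_eq h).trans ?_))
  · exact (whiskerLeft_comp_same _ _ _).trans ((hq.whiskerLeft _).comp_left _).symm
  -- The factor with `T (K lam)` is the image of `lam` restricted along `r`, an identity. Since `K
  -- p` is strict, the cell of `K (p ≫ f)` is that of `K f` restricted along `T (K p)`, and `r ≫ p =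
  -- 𝟙` undoes this restriction.
  · refine (IsOfEq.comp_left ?_ _).trans ?_
    · refine (whiskerLeft_whiskerRight_same _ _ _).symm.isOfEq (IsOfEq.whiskerRight ?_ _)
      refine (mapCell_whiskerLeft_same _ _ _).isOfEq (IsOfEq.mapCell ?_ _)
      exact (mapCell_whiskerLeft_same (K.comp (M.forget k)) _ _).isOfEq (hlam.mapCell _)
    · have e : AlgHom.f (K.map r) ≫ AlgHom.f (K.map p) = 𝟙 _ := by
        have h := congrArg AlgHom.f ((K.map_comp r p).symm.trans
          ((congrArg K.map hr).trans (K.map_id a)))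
        exact h
      refine (((AlgHom.cell_same_of_eq (K.map_comp p f)).trans
        (AlgHom.comp_cell_same_of_isOfEq _ _ hp)).whiskerLeft rfl).trans
        ((whiskerLeft_comp_same _ _ _).symm.trans (whiskerLeft_same_of_eq_id _ ?_))
      rw [← M.T.map_comp, e, M.T.map_id]

end

/-- `cell_nat` concerns lax and colax cells; the pseudo case of uniqueness is reached by including
pseudo cells among lax ones. -/
theorem exists_le_lax_or_colax (hs : k ≠ .s) : ∃ k', (k' = .l ∨ k' = .c) ∧ Le k k' := by
  cases k
  · exact (hs rfl).elim
  · exact ⟨.l, Or.inl rfl, trivial⟩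
  · exact ⟨.l, Or.inl rfl, trivial⟩
  · exact ⟨.c, Or.inr rfl, trivial⟩

variable {𝔸 : FCat.{w, v, u}}

/-- Two `F`-functors to algebras which agree on objects and after forgetting the structure are
equal, when the domain has limits of loose morphisms. -/
theorem ffunctor_ext (hs : k ≠ .s) (h𝔸 : 𝔸.HasBarLimits k) {K K' : FFunctor 𝔸 (M.algF k)}
    (hobj : ∀ a, K.obj a = K'.obj a) (hU : K.comp (M.forgetF k) = K'.comp (M.forgetF k)) :
    K = K' := by
  obtain ⟨k', hk', hkk⟩ := exists_le_lax_or_colax hs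
  -- The right-hand side depends on `K` only through its objects and its composite with the
  -- forgetful `F`-functor. After inclusion into `k'` the cone need not be a limit, but only its
  -- section and strict legs are used.
  have formula (K : FFunctor 𝔸 (M.algF k)) {a b x : 𝔸.carrier} {f : a ⟶ b} {C : FCat.BarCone k f x}
      (hC : C.IsLimit) (r : a ⟶ x) (hr : r ≫ C.r = 𝟙 a) (hα : IsOfEq (C.α.whiskerLeft r)) :
      (AlgHom.cell (K.map f)).incl hkk ≋
        ((C.α.incl hkk).mapCell (K.comp (M.forgetF k)).toStrictPseudofunctor).whiskerLeft
          (M.T.map ((K.comp (M.forgetF k)).map r) ≫ (K.obj x).alg.str) :=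
    cell_same_of_section hk' (K.toStrictPseudofunctor.comp (M.inclusion hkk)) (C.α.incl hkk) r hr
      (incl_whiskerLeft hkk r C.α ▸ hα.incl hkk)
      ((isOfEq_cell_of_tight (K.map_tight _ hC.tight_r)).incl hkk)
      ((isOfEq_cell_of_tight (K.map_tight _ hC.tight_s)).incl hkk)
  have hmap : ∀ {a b : 𝔸.carrier} (f : a ⟶ b), HEq (K.map f) (K'.map f) := by
    intro a b f
    obtain ⟨x, C, hC⟩ := h𝔸 a b f
    obtain ⟨r, hr, -, hα⟩ := hC.exists_section
    exact AlgHom.heq_of_cell_same hs hkk (congrArg Alg.alg (hobj a)) (congrArg Alg.alg (hobj b))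
      (congrArg Alg.alg (hobj x)) (FFunctor.map_heq hU f) (FFunctor.map_heq hU r)
      (FFunctor.map_heq hU C.s) (FFunctor.map_heq hU (C.r ≫ f))
      (FFunctor.mapCell_heq hU (C.α.incl hkk)) (formula K hC r hr hα) (formula K' hC r hr hα)
  exact FFunctor.ext_heq hobj hmap fun {a b f g} α =>
    AlgHom.hom₂_heq (hobj a) (hobj b) (hmap f) (hmap g) (FFunctor.map₂_heq hU α)

end TwoMonad

/-! ### Assembling structure cells into an `F`-functor -/

section Lift

variable {B : Type u₁} [Bicategory.{w₁, v₁} B] [Strict B]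

/-- Data lifting an `F`-functor to a 2-category along the forgetful `F`-functor from algebras and
`k`-morphisms. -/
structure AlgLift {𝔸 : FCat.{w, v, u}} (M : TwoMonad B) (k : Weakness)
    (H : FFunctor 𝔸 (FCat.of B)) where
  str : ∀ a : 𝔸.carrier, M.T.obj (H.obj a) ⟶ H.obj a
  str_unit : ∀ a, M.η (H.obj a) ≫ str a = 𝟙 (H.obj a)
  str_mul : ∀ a, M.μ (H.obj a) ≫ str a = M.T.map (str a) ≫ str a
  cell : ∀ {a b : 𝔸.carrier} (f : a ⟶ b),
    Cell k (M.T.map (H.map f) ≫ str b) (str a ≫ H.map f)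
  cell_unit : ∀ {a b : 𝔸.carrier} (f : a ⟶ b),
    IsOfEq ((cell f).whiskerLeft (M.η (H.obj a)))
  cell_mul : ∀ {a b : 𝔸.carrier} (f : a ⟶ b), (cell f).whiskerLeft (M.μ (H.obj a)) ≋
    (((cell f).mapCell M.T).whiskerRight (str b)).comp
      (((cell f).whiskerLeft (M.T.map (str a))).cast
        ((congrArg (· ≫ str b) (M.T.map_comp _ _)).trans (Strict.assoc _ _ _)) rfl)
  cell_tight : ∀ {a b : 𝔸.carrier} (f : a ⟶ b), 𝔸.tight.mem f → IsOfEq (cell f)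
  cell_comp : ∀ {a b c : 𝔸.carrier} (f : a ⟶ b) (g : b ⟶ c), cell (f ≫ g) ≋
    ((cell g).whiskerLeft (M.T.map (H.map f))).comp
      (((cell f).whiskerRight (H.map g)).cast (Strict.assoc _ _ _).symm (Strict.assoc _ _ _))
  cell_square : ∀ {a b : 𝔸.carrier} {f g : a ⟶ b} (α : f ⟶ g),
    Square (cell f) (cell g) (M.T.map₂ (H.map₂ α) ▷ str b) (str a ◁ H.map₂ α)

namespace AlgLift

variable {𝔸 : FCat.{w, v, u}} {M : TwoMonad B} {k : Weakness} {H : FFunctor 𝔸 (FCat.of B)}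
  (D : AlgLift M k H)

theorem cell_same_of_eq {a b : 𝔸.carrier} {f g : a ⟶ b} (h : f = g) : D.cell f ≋ D.cell g := by
  subst h; exact Same.refl _

/-- The algebra structure on the image of an object. -/
def algebra (a : 𝔸.carrier) : M.Algebra where
  obj := H.obj a
  str := D.str a
  unit := D.str_unit a
  mul := D.str_mul a

/-- The `k`-morphism structure on the image of a loose 1-cell. -/
def algHom {a b : 𝔸.carrier} (f : a ⟶ b) :
    TwoMonad.AlgHom k (D.algebra a) (D.algebra b) where
  f := H.map f
  cell := D.cell f
  unit := ((D.cell_unit f).same (isOfEq_ofEq _) rfl).eq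
  mul := by
    refine ((D.cell_mul f).trans (Same.symm ((isOfEq_ofEq _).comp_left _ |>.trans
      ((Same.refl _).comp ?_)))).eq
    exact ((isOfEq_ofEq _).comp_left _).trans
      ((IsOfEq.comp_right _ (isOfEq_ofEq _)).trans (cast_same _ _ _).symm)

/-- The lifted `F`-functor. -/
def toFFunctor : FFunctor 𝔸 (M.algF k) where
  toStrictPseudofunctor := StrictPseudofunctor.mk''
    { obj := fun a => ⟨D.algebra a⟩
      map := fun f => D.algHom f
      map₂ := fun α => ⟨H.map₂ α, D.cell_square α⟩
      map₂_id := fun f => TwoMonad.Alg.hom₂_ext (H.map₂_id f)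
      map₂_comp := fun α β => TwoMonad.Alg.hom₂_ext (H.map₂_comp α β)
      -- Identities are tight, so preservation of identities needs no separate axiom on cells.
      map_id := fun a => TwoMonad.AlgHom.ext_cell (H.map_id a)
        ((D.cell_tight _ (𝔸.tight.id_mem a)).same (isOfEq_ofEq _)
          (by simp only [H.map_id]; rfl)).2.2
      map_comp := fun f g => TwoMonad.AlgHom.ext_cell (H.map_comp f g)
        ((D.cell_comp f g).trans (TwoMonad.AlgHom.comp_cell_same (D.algHom f) (D.algHom g)).symm).2.2
      map₂_whisker_left := fun f _ _ η => by
        refine TwoMonad.Alg.hom₂_ext (Eq.trans ?_ (TwoMonad.Alg.conj_hom _ _ _).symm)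
        refine (H.map₂_whisker_left f η).trans ?_
        simp only [StrictPseudofunctor.mapComp_eq_eqToIso]
        rfl
      map₂_whisker_right := fun η f => by
        refine TwoMonad.Alg.hom₂_ext (Eq.trans ?_ (TwoMonad.Alg.conj_hom _ _ _).symm)
        refine (H.map₂_whisker_right η f).trans ?_
        simp only [StrictPseudofunctor.mapComp_eq_eqToIso]
        rfl }
  map_tight f hf := by
    obtain ⟨h, e⟩ := D.cell_tight f hf
    exact ⟨⟨H.map f, ofEq h .s, rfl, rfl⟩, TwoMonad.AlgHom.ext_cell rfl (heq_of_eq e)⟩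

/-- Restriction of a lift along an `F`-functor. -/
def restrict {𝔻 : FCat.{w₂, v₂, u₂}} (J : FFunctor 𝔻 𝔸) : AlgLift M k (J.comp H) where
  str a := D.str (J.obj a)
  str_unit a := D.str_unit (J.obj a)
  str_mul a := D.str_mul (J.obj a)
  cell f := D.cell (J.map f)
  cell_unit f := D.cell_unit (J.map f)
  cell_mul f := D.cell_mul (J.map f)
  cell_tight f hf := D.cell_tight _ (J.map_tight f hf)
  cell_comp f g := (D.cell_same_of_eq (J.map_comp f g)).trans (D.cell_comp (J.map f) (J.map g))
  cell_square α := D.cell_square (J.map₂ α)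

/-- A lift whose cells underlie invertible ones is a lift to pseudomorphisms. -/
def ofIncl (hk : Le .p k)
    (cell : ∀ {a b : 𝔸.carrier} (f : a ⟶ b),
      Cell .p (M.T.map (H.map f) ≫ D.str b) (D.str a ≫ H.map f))
    (h : ∀ {a b : 𝔸.carrier} (f : a ⟶ b), (cell f).incl hk = D.cell f) : AlgLift M .p H where
  str := D.str
  str_unit := D.str_unit
  str_mul := D.str_mul
  cell := cell
  cell_unit f := by
    refine IsOfEq.of_incl hk nofun ?_
    rw [incl_whiskerLeft, h]
    exact D.cell_unit f
  cell_mul f := by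
    refine Same.of_incl hk nofun ?_
    rw [incl_comp, incl_cast, incl_whiskerLeft, incl_whiskerLeft, incl_whiskerRight,
      incl_mapCell, h]
    exact D.cell_mul f
  cell_tight f hf := by
    refine IsOfEq.of_incl hk nofun ?_
    rw [h]
    exact D.cell_tight f hf
  cell_comp f g := by
    refine Same.of_incl hk nofun ?_
    rw [incl_comp, incl_cast, incl_whiskerLeft, incl_whiskerRight, h, h, h]
    exact D.cell_comp f g
  cell_square α := by
    refine square_of_incl hk ?_
    rw [h, h]
    exact D.cell_square α

theorem toFFunctor_over : D.toFFunctor.comp (M.forgetF k) = H :=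
  FFunctor.ext_heq (fun _ => rfl) (fun _ => HEq.rfl) (fun _ => HEq.rfl)

end AlgLift

end Lift

/-! ### Construction of the two extensions -/

namespace F2Cat

variable {B : Type u₁} [Bicategory.{w₁, v₁} B] [Strict B] {𝔸 : F2Cat.{w, v, u}}
  {H : FFunctor 𝔸.tightVeryLoose (FCat.of B)} {F : StrictPseudofunctor B 𝔸.Aτ}
  (adj : TwoAdjunction F (𝔸.incVeryLoose.comp H).toStrictPseudofunctor) {k : Weakness}

/-- The comonad of the adjunction, extended to all very loose 1-cells. -/
def tightCounit : FCat.TightCounit 𝔸.tightVeryLoose where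
  P := (H.toStrictPseudofunctor.comp F).comp (WideSubcat.Sub.forget 𝔸.tight)
  tight_map f := WideSubcat.Sub.Hom.mem (F.map (H.map f))
  counit a := WideSubcat.Sub.Hom.hom (adj.counit ⟨a⟩)
  tight_counit a := WideSubcat.Sub.Hom.mem (adj.counit ⟨a⟩)
  nat {a b} s hs := congrArg WideSubcat.Sub.Hom.hom
    (adj.counit_nat (a := ⟨a⟩) (a' := ⟨b⟩) (WideSubcat.Sub.Hom.mk s hs))

theorem map_comp_counit {a b : 𝔸.carrier} (f : a ⟶ b) :
    H.map ((tightCounit adj).P.map f ≫ (tightCounit adj).counit b) =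
      adj.toTwoMonad.T.map (H.map f) ≫ (adj.algebra ⟨b⟩).str := H.map_comp _ _

theorem map_counit_comp {a b : 𝔸.carrier} (f : a ⟶ b) :
    H.map ((tightCounit adj).counit a ≫ f) = (adj.algebra ⟨a⟩).str ≫ H.map f := H.map_comp _ _

/-- Both sides apply `H`, then `F`, then `H`, with different bracketing: this is `HP = TH`. -/
theorem mapCell_counit_same {a b : 𝔸.carrier} {f g : a ⟶ b} (α : Cell k f g) :
    (α.mapCell (tightCounit adj).P).mapCell H.toStrictPseudofunctor ≋
      (α.mapCell H.toStrictPseudofunctor).mapCell adj.toTwoMonad.T :=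
  Same.of_eq ((mapCell_mapCell (tightCounit adj).P H.toStrictPseudofunctor α).trans
    (mapCell_mapCell H.toStrictPseudofunctor adj.toTwoMonad.T α).symm)

variable (hw : 𝔸.tightVeryLoose.HasBarLimits k)

/-- The structure cell on `Hf`. -/
noncomputable def algCell {a b : 𝔸.carrier} (f : a ⟶ b) :
    Cell k (adj.toTwoMonad.T.map (H.map f) ≫ (adj.algebra ⟨b⟩).str)
      ((adj.algebra ⟨a⟩).str ≫ H.map f) :=
  (((tightCounit adj).bar hw f).mapCell H.toStrictPseudofunctor).cast
    (map_comp_counit adj f).symm (map_counit_comp adj f)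

theorem algCell_same {a b : 𝔸.carrier} (f : a ⟶ b) : algCell adj hw f ≋
    ((tightCounit adj).bar hw f).mapCell H.toStrictPseudofunctor := cast_same _ _ _

/-- By naturality of `η` and the unit law at `x`, restricting along `η` turns `H (P r ≫ counit)`
into `H r`, and the limit cone is an identity along `r`. -/
theorem isOfEq_whiskerLeft_unit {a b : 𝔸.carrier} (f : a ⟶ b) :
    IsOfEq ((algCell adj hw f).whiskerLeft (adj.toTwoMonad.η (H.obj a))) := by
  obtain ⟨x, C, hC⟩ := hw a b f
  obtain ⟨r, hr₁, -, hr⟩ := hC.exists_section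
  have e : adj.toTwoMonad.η (H.obj a) ≫
      H.map ((tightCounit adj).P.map r ≫ (tightCounit adj).counit x) = H.map r := by
    refine (congrArg (adj.toTwoMonad.η (H.obj a) ≫ ·) (map_comp_counit adj r)).trans ?_
    refine (Strict.assoc _ _ _).symm.trans ?_
    refine (congrArg (· ≫ (adj.algebra ⟨x⟩).str) (adj.toTwoMonad.η_nat (H.map r)).symm).trans ?_
    refine (Strict.assoc _ _ _).trans ?_
    exact (congrArg (H.map r ≫ ·) (adj.algebra ⟨x⟩).unit).trans (Strict.comp_id _)
  have h := ((tightCounit adj).cone_same_bar_of_section hw C r hC.tight_r hC.tight_s hr hr₁).symm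
  refine (((algCell_same adj hw f).trans ((h.mapCell H.toStrictPseudofunctor).trans
    (mapCell_whiskerLeft_same _ _ _))).whiskerLeft rfl).symm.isOfEq ?_
  refine ((whiskerLeft_comp_same _ _ _).symm.trans ((Same.refl _).whiskerLeft e)).symm.isOfEq ?_
  exact (mapCell_whiskerLeft_same H.toStrictPseudofunctor r C.α).isOfEq (hr.mapCell _)

/-- This is `bar_nat` for the cell `bar f` itself, with `μ` being `H` of the counit at `P a`. The
source `P f ≫ counit` of `bar f` is tight, so its own canonical cell disappears; its target `counit
≫ f` starts with a tight 1-cell, so `bar_precomp` applies. -/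
theorem whiskerLeft_mul (hk : k = .l ∨ k = .c) {a b : 𝔸.carrier} (f : a ⟶ b) :
    (algCell adj hw f).whiskerLeft (adj.toTwoMonad.μ (H.obj a)) ≋
      (((algCell adj hw f).mapCell adj.toTwoMonad.T).whiskerRight (adj.algebra ⟨b⟩).str).comp
        (((algCell adj hw f).whiskerLeft (adj.toTwoMonad.T.map (adj.algebra ⟨a⟩).str)).cast
          ((congrArg (· ≫ (adj.algebra ⟨b⟩).str) (adj.toTwoMonad.T.map_comp _ _)).trans
            (Strict.assoc _ _ _)) rfl) := by
  have h := congrArg (Cell.mapCell H.toStrictPseudofunctor)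
    ((tightCounit adj).bar_nat hw hk ((tightCounit adj).bar hw f))
  rw [mapCell_vcomp, mapCell_vcomp] at h
  have t := (tightCounit adj).bar_tight hw (𝔸.tightVeryLoose.tight.comp_mem _ _
    ((tightCounit adj).tight_map f) ((tightCounit adj).tight_counit b))
  refine Same.trans ?_ ((Same.of_eq h).trans (Same.comp ?_ ?_))
  · refine Same.trans ?_ ((t.mapCell _).comp_left _).symm
    exact ((algCell_same adj hw f).whiskerLeft rfl).trans (mapCell_whiskerLeft_same _ _ _).symm
  · refine (mapCell_whiskerRight_same H.toStrictPseudofunctor _ _).trans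
      (Same.whiskerRight ?_ rfl)
    refine Same.trans ?_ (((algCell_same adj hw f).mapCell adj.toTwoMonad.T).symm)
    exact mapCell_counit_same adj _
  · refine Same.trans ?_ (cast_same _ _ _).symm
    refine (((tightCounit adj).bar_precomp hw ((tightCounit adj).tight_counit a) f).mapCell
      H.toStrictPseudofunctor).trans ((mapCell_whiskerLeft_same _ _ _).trans ?_)
    exact (algCell_same adj hw f).symm.whiskerLeft rfl

theorem isOfEq_algCell {a b : 𝔸.carrier} {f : a ⟶ b} (hf : 𝔸.tight.mem f) :
    IsOfEq (algCell adj hw f) :=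
  (algCell_same adj hw f).symm.isOfEq (((tightCounit adj).bar_tight hw hf).mapCell _)

theorem algCell_comp (hk : k = .l ∨ k = .c) {a b c : 𝔸.carrier} (f : a ⟶ b) (g : b ⟶ c) :
    algCell adj hw (f ≫ g) ≋
      ((algCell adj hw g).whiskerLeft (adj.toTwoMonad.T.map (H.map f))).comp
        (((algCell adj hw f).whiskerRight (H.map g)).cast (Strict.assoc _ _ _).symm
          (Strict.assoc _ _ _)) := by
  refine (algCell_same adj hw _).trans ((((tightCounit adj).bar_comp hw hk f g).mapCell
    H.toStrictPseudofunctor).trans ?_)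
  rw [mapCell_vcomp]
  refine Same.comp ?_ ?_
  · exact (mapCell_whiskerLeft_same H.toStrictPseudofunctor _ _).trans
      ((algCell_same adj hw g).symm.whiskerLeft rfl)
  · refine Same.trans ((cast_same _ _ _).mapCell H.toStrictPseudofunctor) ?_
    refine Same.trans ?_ (cast_same _ _ _).symm
    exact (mapCell_whiskerRight_same H.toStrictPseudofunctor _ _).trans
      ((algCell_same adj hw f).symm.whiskerRight rfl)

theorem algCell_nat (hk : k = .l ∨ k = .c) {a b : 𝔸.carrier} {f g : a ⟶ b} (α : Cell k f g) :
    (algCell adj hw f).comp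
        ((α.mapCell H.toStrictPseudofunctor).whiskerLeft (adj.algebra ⟨a⟩).str) =
      (((α.mapCell H.toStrictPseudofunctor).mapCell adj.toTwoMonad.T).whiskerRight
        (adj.algebra ⟨b⟩).str).comp (algCell adj hw g) := by
  have h := congrArg (Cell.mapCell H.toStrictPseudofunctor)
    ((tightCounit adj).bar_nat hw hk α)
  rw [mapCell_vcomp, mapCell_vcomp] at h
  refine ((Same.comp (algCell_same adj hw f) ?_).trans ((Same.of_eq h).trans
    (Same.comp ?_ (algCell_same adj hw g).symm))).eq
  · exact (mapCell_whiskerLeft_same H.toStrictPseudofunctor _ _).symm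
  · refine (mapCell_whiskerRight_same H.toStrictPseudofunctor _ _).trans
      (Same.whiskerRight ?_ rfl)
    exact mapCell_counit_same adj α

theorem algCell_square (hk : k = .l ∨ k = .c) {a b : 𝔸.carrier} {f g : a ⟶ b} (α : f ⟶ g) :
    Square (algCell adj hw f) (algCell adj hw g)
      (adj.toTwoMonad.T.map₂ (H.map₂ α) ▷ (adj.algebra ⟨b⟩).str)
      ((adj.algebra ⟨a⟩).str ◁ H.map₂ α) := by
  rcases hk with rfl | rfl
  · exact (algCell_nat adj hw (Or.inl rfl) (f := f) (g := g) α).symm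
  -- A 2-cell `f ⟶ g` is a `c`-cell from `g` to `f`.
  · exact (algCell_nat adj hw (Or.inr rfl) (f := g) (g := f) α).symm

/-- The lift of `H` to `k`-morphisms of algebras. -/
noncomputable def algLift (hk : k = .l ∨ k = .c) : AlgLift adj.toTwoMonad k H where
  str a := (adj.algebra ⟨a⟩).str
  str_unit a := (adj.algebra ⟨a⟩).unit
  str_mul a := (adj.algebra ⟨a⟩).mul
  cell f := algCell adj hw f
  cell_unit f := isOfEq_whiskerLeft_unit adj hw f
  cell_mul f := whiskerLeft_mul adj hw hk f
  cell_tight _ hf := isOfEq_algCell adj hw hf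
  cell_comp f g := algCell_comp adj hw hk f g
  cell_square α := algCell_square adj hw hk α

/-- The structure cell on the image of a 1-cell with a pseudolimit is invertible. -/
theorem exists_pseudo_algCell (hpk : Le .p k) (hp : 𝔸.tightLoose.HasBarLimits .p)
    {a b : 𝔸.loose.Sub} (f : a ⟶ b) :
    ∃ β : Cell .p (adj.toTwoMonad.T.map (H.map (WideSubcat.Sub.Hom.hom f)) ≫
        (adj.algebra ⟨b.obj⟩).str)
      ((adj.algebra ⟨a.obj⟩).str ≫ H.map (WideSubcat.Sub.Hom.hom f)),
      β.incl hpk = algCell adj hw (WideSubcat.Sub.Hom.hom f) := by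
  obtain ⟨x, C, hC⟩ := hp a b f
  obtain ⟨r, hr₁, -, hr⟩ := hC.exists_section
  let V := WideSubcat.Sub.forget 𝔸.loose
  let γ : Cell .p (V.map C.s) (V.map C.r ≫ V.map f) := C.α.mapCell V
  have hγ : IsOfEq (γ.whiskerLeft (V.map r)) :=
    (mapCell_whiskerLeft_same V r C.α).isOfEq (hr.mapCell V)
  -- The pseudolimit cone need not be a limit among very loose 1-cells. Its tight legs, and a
  -- section along which it is an identity, suffice to compute the canonical cell of `f`.
  let D : FCat.BarCone (𝔸 := 𝔸.tightVeryLoose) k (V.map f) (V.obj x) :=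
    ⟨V.map C.r, V.map C.s, γ.incl hpk⟩
  have h := (tightCounit adj).cone_same_bar_of_section hw D (V.map r) hC.tight_r hC.tight_s
    (incl_whiskerLeft hpk _ γ ▸ hγ.incl hpk) (congrArg WideSubcat.Sub.Hom.hom hr₁)
  have h' := (h.mapCell H.toStrictPseudofunctor).trans (algCell_same adj hw (V.map f)).symm
  refine ⟨((γ.whiskerLeft ((tightCounit adj).P.map (V.map r) ≫
    (tightCounit adj).counit (V.obj x))).mapCell H.toStrictPseudofunctor).cast
      h'.1.symm h'.2.1, Same.eq ?_⟩
  refine (Same.of_eq (incl_cast hpk _ _ _)).trans ((cast_same _ _ _).trans (Same.trans ?_ h'))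
  exact Same.of_eq ((incl_mapCell hpk _ _).trans
    (congrArg (Cell.mapCell H.toStrictPseudofunctor) (incl_whiskerLeft hpk _ γ)))

/-- The lift of the restriction of `H` to loose 1-cells to pseudomorphisms of algebras. -/
noncomputable def pseudoAlgLift (hk : k = .l ∨ k = .c) (hp : 𝔸.tightLoose.HasBarLimits .p) :
    AlgLift adj.toTwoMonad .p (𝔸.j.comp H) :=
  ((algLift adj hw hk).restrict 𝔸.j).ofIncl (p_le hk)
    (fun f => (exists_pseudo_algCell adj hw (p_le hk) hp f).choose)
    (fun f => (exists_pseudo_algCell adj hw (p_le hk) hp f).choose_spec)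

theorem incl_pseudoAlgLift_cell (hk : k = .l ∨ k = .c) (hp : 𝔸.tightLoose.HasBarLimits .p)
    {a b : 𝔸.loose.Sub} (f : a ⟶ b) : ((pseudoAlgLift adj hw hk hp).cell f).incl (p_le hk) =
      algCell adj hw (WideSubcat.Sub.Hom.hom f) :=
  (exists_pseudo_algCell adj hw (p_le hk) hp f).choose_spec

/-- Objects, underlying 1-cells and 2-cells agree by construction; on tight 1-cells both structure
cells are identities. -/
theorem isExtensionOver_algLift (hk : k = .l ∨ k = .c) :
    IsExtensionOver 𝔸.incVeryLoose adj.comparison H (algLift adj hw hk).toFFunctor where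
  extends_E := by
    have hmap {a b : 𝔸.Aτ} (f : a ⟶ b) :
        (𝔸.incVeryLoose.comp (algLift adj hw hk).toFFunctor).map f =
          ((FFunctor.of adj.comparison).comp (adj.toTwoMonad.inclS k)).map f :=
      TwoMonad.AlgHom.ext_cell rfl
        ((isOfEq_algCell adj hw (WideSubcat.Sub.Hom.mem f)).same (isOfEq_ofEq _) rfl).2.2
    exact FFunctor.ext_heq (fun _ => rfl) (fun f => heq_of_eq (hmap f)) fun {_ _ f g} α =>
      TwoMonad.AlgHom.hom₂_heq rfl rfl (heq_of_eq (hmap f)) (heq_of_eq (hmap g)) HEq.rfl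
  over_B := AlgLift.toFFunctor_over _

theorem isExtensionOver_pseudoAlgLift (hk : k = .l ∨ k = .c)
    (hp : 𝔸.tightLoose.HasBarLimits .p) :
    IsExtensionOver 𝔸.incLoose adj.comparison (𝔸.j.comp H)
      (pseudoAlgLift adj hw hk hp).toFFunctor where
  extends_E := by
    have hmap {a b : 𝔸.Aτ} (f : a ⟶ b) :
        (𝔸.incLoose.comp (pseudoAlgLift adj hw hk hp).toFFunctor).map f =
          ((FFunctor.of adj.comparison).comp (adj.toTwoMonad.inclS .p)).map f :=
      TwoMonad.AlgHom.ext_cell rfl (((pseudoAlgLift adj hw hk hp).cell_tight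
        (𝔸.incLoose.map f) (WideSubcat.Sub.Hom.mem f)).same (isOfEq_ofEq _) rfl).2.2
    exact FFunctor.ext_heq (fun _ => rfl) (fun f => heq_of_eq (hmap f)) fun {_ _ f g} α =>
      TwoMonad.AlgHom.hom₂_heq rfl rfl (heq_of_eq (hmap f)) (heq_of_eq (hmap g)) HEq.rfl
  over_B := AlgLift.toFFunctor_over _

/-- The pseudo structure cell was chosen as an invertible cell whose inclusion is `algCell`, so the
two sides have the same structure cells. -/
theorem j_comp_algLift (hk : k = .l ∨ k = .c) (hp : 𝔸.tightLoose.HasBarLimits .p) :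
    𝔸.j.comp (algLift adj hw hk).toFFunctor =
      (pseudoAlgLift adj hw hk hp).toFFunctor.comp (adj.toTwoMonad.inclF (p_le hk)) := by
  have hmap {a b : 𝔸.loose.Sub} (f : a ⟶ b) :
      (𝔸.j.comp (algLift adj hw hk).toFFunctor).map f =
        ((pseudoAlgLift adj hw hk hp).toFFunctor.comp (adj.toTwoMonad.inclF (p_le hk))).map f :=
    TwoMonad.AlgHom.ext_cell rfl (heq_of_eq (incl_pseudoAlgLift_cell adj hw hk hp f).symm)
  exact FFunctor.ext_heq (fun _ => rfl) (fun f => heq_of_eq (hmap f)) fun {_ _ f g} α =>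
    TwoMonad.AlgHom.hom₂_heq rfl rfl (heq_of_eq (hmap f)) (heq_of_eq (hmap g)) HEq.rfl

end F2Cat

/-! ### Conclusion -/

/-- Extensions over `B` along a functor surjective on objects are unique when the domain has
limits of loose morphisms. -/
theorem IsExtensionOver.unique {A : Type u₁} [Bicategory.{w₁, v₁} A] [Strict A]
    {𝔸 : FCat.{w, v, u}} {B : Type u₂} [Bicategory.{w₂, v₂} B] [Strict B] {M : TwoMonad B}
    {k : Weakness} {i : FFunctor (FCat.of A) 𝔸} {E : StrictPseudofunctor A (M.Alg .s)}
    {H : FFunctor 𝔸 (FCat.of B)} (hs : k ≠ .s) (h𝔸 : 𝔸.HasBarLimits k)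
    (hi : Function.Surjective i.obj) {K K' : FFunctor 𝔸 (M.algF k)}
    (hK : IsExtensionOver i E H K) (hK' : IsExtensionOver i E H K') : K = K' := by
  -- Agreement with `E` is used on objects only; the limits determine the rest.
  refine TwoMonad.ffunctor_ext hs h𝔸 (fun a => ?_) (hK.over_B.trans hK'.over_B.symm)
  obtain ⟨x, rfl⟩ := hi a
  exact congrFun (congrArg (fun G : FFunctor (FCat.of A) (M.algF k) => G.obj)
    (hK.extends_E.trans hK'.extends_E.symm)) x

theorem mainTheorem5 (k : Weakness) (hk : k = .l ∨ k = .c)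
    (B : Type u₁) [Bicategory.{w₁, v₁} B] [Strict B]
    (𝔸 : F2Cat.{w, v, u}) (H : FFunctor 𝔸.tightVeryLoose (FCat.of B))
    (F : StrictPseudofunctor B 𝔸.Aτ)
    (adj : TwoAdjunction F (𝔸.incVeryLoose.comp H).toStrictPseudofunctor)
    (hp : 𝔸.tightLoose.HasBarLimits .p) (hw : 𝔸.tightVeryLoose.HasBarLimits k) :
    ∃ (Ep : FFunctor 𝔸.tightLoose (adj.toTwoMonad.algF .p))
      (Ew : FFunctor 𝔸.tightVeryLoose (adj.toTwoMonad.algF k)),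
      (IsExtensionOver 𝔸.incLoose adj.comparison (𝔸.j.comp H) Ep ∧
        ∀ K, IsExtensionOver 𝔸.incLoose adj.comparison (𝔸.j.comp H) K → K = Ep) ∧
      (IsExtensionOver 𝔸.incVeryLoose adj.comparison H Ew ∧
        ∀ K, IsExtensionOver 𝔸.incVeryLoose adj.comparison H K → K = Ew) ∧
      𝔸.j.comp Ew = Ep.comp (adj.toTwoMonad.inclF (Weakness.p_le hk)) := by
  have h₁ := F2Cat.isExtensionOver_pseudoAlgLift adj hw hk hp
  have h₂ := F2Cat.isExtensionOver_algLift adj hw hk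
  have hs : k ≠ .s := by rcases hk with rfl | rfl <;> exact nofun
  have hi : Function.Surjective 𝔸.incLoose.obj := fun a => ⟨⟨WideSubcat.Sub.obj a⟩, rfl⟩
  have hi' : Function.Surjective 𝔸.incVeryLoose.obj := fun a => ⟨⟨a⟩, rfl⟩
  have hps : Weakness.p ≠ .s := nofun
  exact ⟨_, _, ⟨h₁, fun K hK => hK.unique hps hp hi h₁⟩, ⟨h₂, fun K hK => hK.unique hs hw hi' h₂⟩,
    F2Cat.j_comp_algLift adj hw hk hp⟩
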